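/- Let $n>2$. For $u:\mathbb R^n\to\mathbb R$ of class $C^2$ with $|Du|<1$, let $\lambda_1,\dots,\lambda_n$ be the principal curvatures of the graph of $u$ in the Minkowski space $\mathbb R^{n,1}$, i.e. the eigenvalues of the shape operator $$h^i_j=\frac{1}{\sqrt{1-|Du|^2}}\sum_{k=1}^n\Big(\delta_{ik}+\frac{\partial_iu\,\partial_ku}{1-|Du|^2}\Big)\partial^2_{kj}u,$$ and let $\mathcal H_k[u]=\frac{k!(n-k)!}{n!}\sigma_k(\lambda_1,\dots,\lambda_n)$, where $\sigma_k$ is the $k$-th elementary symmetric function. Such a $u$ is called admissible if $\mathcal H_1[u]>0$ and $\mathcal H_2[u]>0$ on $\mathbb R^n$. Let $C>1$ and let $H:[0,+\infty)\to\mathbb R$ be a non-decreasing function such that $x\in\mathbb R^n\mapsto H(|x|)$ is smooth, $\inf_{[0,+\infty)}H>1$ and $H(r)\to C$ as $r\to+\infty$. Then there exists a radial admissible function $u:\mathbb R^n\to\mathbb R$ solving the downward soliton equation $$\mathcal H_2[u]^{1/2}(x)=H(|x|)-\frac{1}{\sqrt{1-|Du(x)|^2}}\qquad (x\in\mathbb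 R^n).$$ It is strictly convex (with positive definite Hessian everywhere) and satisfies $|Du(x)|\to\sqrt{1-1/C^2}$ as $|x|\to+\infty$. If moreover $H(r)=C\,(1-O(r^{-2}))$ as $r\to+\infty$, then $$u(x)=\sqrt{1-\frac1{C^2}}\;|x|-\frac1{C^2}\sqrt{\frac{n-2}{n}}\,\log|x|+c_0+o(1)\qquad(|x|\to+\infty)$$ for some constant $c_0\in\mathbb R$. The radial admissible solution is unique up to the addition of a constant. -/

import Mathlib

open Set Filter Topology Asymptotics
open scoped Nat ContDiff

noncomputable section

namespace ScalarSoliton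

/-- The induced metric `g_ij = δ_ij - ∂_i u ∂_j u` of the graph of `u` in Minkowski space,
in the chart `(x_1, …, x_n)`. -/
def metric {n : ℕ} (u : EuclideanSpace ℝ (Fin n) → ℝ) (x : EuclideanSpace ℝ (Fin n)) :
    Matrix (Fin n) (Fin n) ℝ :=
  Matrix.of fun i j => (if i = j then 1 else 0) - gradient u x i * gradient u x j

/-- The inverse metric `g^ij = δ_ij + ∂_i u ∂_j u / (1 - |Du|²)` of a spacelike graph. -/
def invMetric {n : ℕ} (u : EuclideanSpace ℝ (Fin n) → ℝ) (x : EuclideanSpace ℝ (Fin n)) :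
    Matrix (Fin n) (Fin n) ℝ :=
  Matrix.of fun i j =>
    (if i = j then 1 else 0) + gradient u x i * gradient u x j / (1 - ‖gradient u x‖ ^ 2)

/-- At a spacelike point, `invMetric` is indeed the inverse of the induced metric. -/
theorem metric_mul_invMetric {n : ℕ} (u : EuclideanSpace ℝ (Fin n) → ℝ)
    (x : EuclideanSpace ℝ (Fin n)) (hx : ‖gradient u x‖ < 1) :
    metric u x * invMetric u x = 1 := by
  have h0 : (1 - ‖gradient u x‖ ^ 2) ≠ 0 := by nlinarith [norm_nonneg (gradient u x)]
  have hs : ∑ k, gradient u x k * gradient u x k = ‖gradient u x‖ ^ 2 := by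
    rw [EuclideanSpace.real_norm_sq_eq]; exact Finset.sum_congr rfl fun k _ => by ring
  ext i j
  have key : ∀ k, metric u x i k * invMetric u x k j =
      (if i = k then (if k = j then 1 else 0) else 0)
      + (if i = k then gradient u x k * gradient u x j / (1 - ‖gradient u x‖ ^ 2) else 0)
      - (if k = j then gradient u x i * gradient u x k else 0)
      - (gradient u x k * gradient u x k) *
        (gradient u x i * gradient u x j / (1 - ‖gradient u x‖ ^ 2)) := by
    intro k
    simp only [metric, invMetric, Matrix.of_apply]
    split_ifs <;> ring
  rw [Matrix.mul_apply, Finset.sum_congr rfl fun k _ => key k]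
  simp only [Finset.sum_sub_distrib, Finset.sum_add_distrib, ← Finset.sum_mul, hs,
    Finset.sum_ite_eq, Finset.sum_ite_eq', Finset.mem_univ, if_true, Matrix.one_apply]
  field_simp
  ring

/-- The Hessian matrix `(∂²_ij u)(x)`, the Jacobian matrix of the gradient field. -/
def hessian {n : ℕ} (u : EuclideanSpace ℝ (Fin n) → ℝ) (x : EuclideanSpace ℝ (Fin n)) :
    Matrix (Fin n) (Fin n) ℝ :=
  Matrix.of fun i j => fderiv ℝ (gradient u) x (EuclideanSpace.single j 1) i

/-- The second fundamental form `h_ij = ∂²_ij u / √(1 - |Du|²)` of the graph of `u`. -/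
def secondFundamentalForm {n : ℕ} (u : EuclideanSpace ℝ (Fin n) → ℝ)
    (x : EuclideanSpace ℝ (Fin n)) : Matrix (Fin n) (Fin n) ℝ :=
  (1 / √(1 - ‖gradient u x‖ ^ 2)) • hessian u x

/-- The shape operator `h^i_j = ∑ k, g^ik h_kj` of the graph of `u`. -/
def shapeOperator {n : ℕ} (u : EuclideanSpace ℝ (Fin n) → ℝ) (x : EuclideanSpace ℝ (Fin n)) :
    Matrix (Fin n) (Fin n) ℝ :=
  invMetric u x * secondFundamentalForm u x

/-- The principal curvatures: the eigenvalues of the shape operator, with multiplicity.  For a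
spacelike `C²` function the shape operator is self-adjoint for the induced metric, so that there
are exactly `n` of them. -/
def principalCurvatures {n : ℕ} (u : EuclideanSpace ℝ (Fin n) → ℝ)
    (x : EuclideanSpace ℝ (Fin n)) : Multiset ℝ :=
  (shapeOperator u x).charpoly.roots

/-- `H_k[u]`: the normalized `k`-th elementary symmetric function of the principal curvatures. -/
def curv {n : ℕ} (k : ℕ) (u : EuclideanSpace ℝ (Fin n) → ℝ) (x : EuclideanSpace ℝ (Fin n)) : ℝ :=
  ((k ! : ℝ) * ((n - k)! : ℝ) / (n ! : ℝ)) * (principalCurvatures u x).esymm k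

/-- Admissible functions: of class `C²`, spacelike, with `H_1[u] > 0` and `H_2[u] > 0`. -/
structure Admissible {n : ℕ} (u : EuclideanSpace ℝ (Fin n) → ℝ) : Prop where
  contDiff : ContDiff ℝ 2 u
  spacelike : ∀ x, ‖gradient u x‖ < 1
  curv_one_pos : ∀ x, 0 < curv 1 u x
  curv_two_pos : ∀ x, 0 < curv 2 u x

/-- The downward soliton equation `H_2[u]^(1/2) = H(|x|) - 1 / √(1 - |Du|²)` on `ℝⁿ`. -/
def SolvesDownwardSoliton {n : ℕ} (H : ℝ → ℝ) (u : EuclideanSpace ℝ (Fin n) → ℝ) : Prop :=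
  ∀ x, √(curv 2 u x) = H ‖x‖ - 1 / √(1 - ‖gradient u x‖ ^ 2)

/-- Radial functions: the value at `x` depends only on `|x|`. -/
def Radial {n : ℕ} (u : EuclideanSpace ℝ (Fin n) → ℝ) : Prop :=
  ∀ x y, ‖x‖ = ‖y‖ → u x = u y

end ScalarSoliton

end

/-! ### Principal curvatures of a rotationally symmetric graph -/

namespace ScalarSoliton

/-! Let p be the radial slope of u, w = p/√(1-p²) and y = w², so that 1/√(1-|Du|²) = √(1+y). For r >
0 the principal curvatures are w/r, n-1 times, and w', so H_2 = (w/r)(2w' + (n-2)w/r)/n and the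
soliton equation becomes (r^(n-2) y)' = n r^(n-1) (H - √(1+y))². Hence Q = y/r² is the mean of (H -
√(1+y))² over [0,r] with weight n s^(n-1)/r^n, a form that is regular at the origin.

Existence: once truncated, the right-hand side is bounded and Lipschitz in y, and the integral map
contracts in a Gaussian weighted sup norm (`exists_integral_solution`). The barrier (n-2)Q < n(H -
√(1+y))², that is y' > 0, holds at 0 and cannot fail for a first time, because there y is
stationary, Q decreases and H does not decrease (`exists_isProfile`). It makes the truncation
inactive and both curvatures positive, which gives admissibility and strict convexity.

Asymptotics: y increases and stays below C²-1; a smaller limit would force y' ≥ 1 eventually. The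
excess e of H - √(1+y) over √((n-2)/n) w/r is positive and bounded by a multiple of y' on (1,∞),
hence integrable there (`integrableOn_excess`). Expanding w/√(1+w²) around √(1+w²) = C gives p =
√(1-1/C²) - C⁻²√((n-2)/n)/r + O(r⁻² + e) (`exists_slope_error_bound`), and integration gives the
expansion of u.

Uniqueness: admissibility forces p > 0, so y determines p. The right-hand side decreases in y as
long as √(1+y) ≤ H, so the squared difference of r^(n-2) y for two solutions is nonincreasing and
starts at 0 (`sq_profile_unique`). -/

theorem charpoly_smul_one_add_vecMulVec (m : ℕ) (a : ℝ) (u v : Fin (m + 1) → ℝ) :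
    (a • (1 : Matrix (Fin (m + 1)) (Fin (m + 1)) ℝ) + Matrix.vecMulVec u v).charpoly =
      (Polynomial.X - Polynomial.C a) ^ m *
        (Polynomial.X - Polynomial.C (a + v ⬝ᵥ u)) := by
  have h : a • (1 : Matrix (Fin (m + 1)) (Fin (m + 1)) ℝ) + Matrix.vecMulVec u v =
      Matrix.vecMulVec u v - Matrix.scalar (Fin (m+1)) (-a) := by
    rw [map_neg, sub_neg_eq_add, Matrix.smul_one_eq_diagonal, Matrix.scalar_apply]
    exact add_comm _ _
  rw [h, Matrix.charpoly_sub_scalar, Matrix.charpoly_vecMulVec]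
  simp [pow_succ, dotProduct_comm, Polynomial.smul_eq_C_mul]
  ring

theorem roots_charpoly_smul_one_add_vecMulVec (m : ℕ) (a : ℝ) (u v : Fin (m + 1) → ℝ) :
    (a • (1 : Matrix (Fin (m + 1)) (Fin (m + 1)) ℝ) + Matrix.vecMulVec u v).charpoly.roots =
      (a + v ⬝ᵥ u) ::ₘ Multiset.replicate m a := by
  rw [charpoly_smul_one_add_vecMulVec, Polynomial.roots_mul, Polynomial.roots_pow,
    Polynomial.roots_X_sub_C, Polynomial.roots_X_sub_C, Multiset.nsmul_singleton, add_comm,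
    Multiset.singleton_add]
  exact mul_ne_zero (pow_ne_zero _ (Polynomial.X_sub_C_ne_zero _)) (Polynomial.X_sub_C_ne_zero _)

theorem esymm_one_cons_replicate (m : ℕ) (a c : ℝ) :
    (c ::ₘ Multiset.replicate m a).esymm 1 = m * a + c := by
  simp [Multiset.esymm, Multiset.powersetCard_one, add_comm]

theorem esymm_two_cons_replicate (m : ℕ) (a c : ℝ) :
    (c ::ₘ Multiset.replicate m a).esymm 2 = m * a * c + m * (m - 1) / 2 * a ^ 2 := by
  have h : (Multiset.map Multiset.prod (Multiset.powersetCard 2 (Multiset.replicate m a))).sum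
      = m * (m - 1) / 2 * a ^ 2 := by
    have : Multiset.map Multiset.prod (Multiset.powersetCard 2 (Multiset.replicate m a)) =
        Multiset.replicate (m.choose 2) (a ^ 2) := by
      rw [Multiset.eq_replicate]
      refine ⟨by simp, fun b hb => ?_⟩
      obtain ⟨s, hs, rfl⟩ := Multiset.mem_map.1 hb
      obtain ⟨hs, hc⟩ := Multiset.mem_powersetCard.1 hs
      have : s = Multiset.replicate 2 a :=
        Multiset.eq_replicate.2 ⟨hc, fun b hb =>
          Multiset.eq_of_mem_replicate (Multiset.mem_of_le hs hb)⟩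
      rw [this, Multiset.prod_replicate]
    rw [this, Multiset.sum_replicate, nsmul_eq_mul, Nat.cast_choose_two]
  rw [Multiset.esymm, Multiset.powersetCard_cons, Multiset.map_add, Multiset.sum_add, h]
  simp [Multiset.powersetCard_one]
  ring

variable {n : ℕ} {u : EuclideanSpace ℝ (Fin n) → ℝ} {x : EuclideanSpace ℝ (Fin n)} {f b : ℝ}

theorem dotProduct_self_eq_norm_sq (x : EuclideanSpace ℝ (Fin n)) :
    (x : Fin n → ℝ) ⬝ᵥ (x : Fin n → ℝ) = ‖x‖ ^ 2 := by
  rw [EuclideanSpace.real_norm_sq_eq]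
  exact Finset.sum_congr rfl fun k _ => by ring

/-- The shape operator at a point where gradient and Hessian have rotationally symmetric form. -/
theorem shapeOperator_of_radial (hg : gradient u x = f • x) (hlt : (f * ‖x‖) ^ 2 < 1)
    (hh : hessian u x = f • (1 : Matrix (Fin n) (Fin n) ℝ) + b • Matrix.vecMulVec x x) :
    shapeOperator u x = (f / √(1 - (f * ‖x‖) ^ 2)) • (1 : Matrix (Fin n) (Fin n) ℝ) +
      Matrix.vecMulVec (((b + f ^ 3 / (1 - (f * ‖x‖) ^ 2) +
        f ^ 2 * b * ‖x‖ ^ 2 / (1 - (f * ‖x‖) ^ 2)) / √(1 - (f * ‖x‖) ^ 2)) • (x : Fin n → ℝ)) x := by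
  have hnorm : ‖gradient u x‖ ^ 2 = (f * ‖x‖) ^ 2 := by
    rw [hg, norm_smul, mul_pow, mul_pow, Real.norm_eq_abs, sq_abs]
  have hI : invMetric u x = 1 + (f ^ 2 / (1 - (f * ‖x‖) ^ 2)) • Matrix.vecMulVec x x := by
    ext i j
    simp only [invMetric, Matrix.of_apply, hnorm]
    simp only [hg, Matrix.add_apply, Matrix.one_apply,
      Matrix.smul_apply, Matrix.vecMulVec_apply, PiLp.smul_apply, smul_eq_mul]
    ring
  have hv : Matrix.vecMulVec (x : Fin n → ℝ) x * Matrix.vecMulVec (x : Fin n → ℝ) x =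
      ‖x‖ ^ 2 • Matrix.vecMulVec (x : Fin n → ℝ) x := by
    rw [Matrix.vecMulVec_mul_vecMulVec, dotProduct_self_eq_norm_sq, Matrix.vecMulVec_smul]
  have h0 : 1 - (f * ‖x‖) ^ 2 ≠ 0 := by linarith
  rw [shapeOperator, secondFundamentalForm, hI, hh, hnorm]
  simp only [Matrix.mul_smul, add_mul, mul_add, Matrix.smul_mul, one_mul, mul_one, hv]
  ext i j
  simp only [Matrix.add_apply, Matrix.smul_apply, Matrix.vecMulVec_apply, Pi.smul_apply,
    smul_eq_mul]
  field_simp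
  ring

theorem principalCurvatures_of_radial (hn : 0 < n) (hg : gradient u x = f • x)
    (hlt : (f * ‖x‖) ^ 2 < 1)
    (hh : hessian u x = f • (1 : Matrix (Fin n) (Fin n) ℝ) + b • Matrix.vecMulVec x x) :
    principalCurvatures u x = ((f + b * ‖x‖ ^ 2) / √(1 - (f * ‖x‖) ^ 2) ^ 3) ::ₘ
      Multiset.replicate (n - 1) (f / √(1 - (f * ‖x‖) ^ 2)) := by
  obtain ⟨m, rfl⟩ : ∃ m, n = m + 1 := ⟨n - 1, by omega⟩
  rw [principalCurvatures, shapeOperator_of_radial hg hlt hh,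
    roots_charpoly_smul_one_add_vecMulVec, dotProduct_smul, dotProduct_self_eq_norm_sq,
    Nat.add_sub_cancel]
  congr 1
  have h0 : 0 < 1 - (f * ‖x‖) ^ 2 := by linarith
  have hs := Real.sqrt_pos.2 h0
  have hsq := (Real.sq_sqrt h0.le).symm
  generalize √(1 - (f * ‖x‖) ^ 2) = s at hs hsq ⊢
  rw [hsq, smul_eq_mul]
  field_simp
  linear_combination (-f - b * ‖x‖ ^ 2) * hsq

theorem curv_one_of_radial (hn : 0 < n) (hg : gradient u x = f • x)
    (hlt : (f * ‖x‖) ^ 2 < 1)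
    (hh : hessian u x = f • (1 : Matrix (Fin n) (Fin n) ℝ) + b • Matrix.vecMulVec x x) :
    curv 1 u x = ((n - 1) * (f / √(1 - (f * ‖x‖) ^ 2)) +
      (f + b * ‖x‖ ^ 2) / √(1 - (f * ‖x‖) ^ 2) ^ 3) / n := by
  rw [curv, principalCurvatures_of_radial hn hg hlt hh, esymm_one_cons_replicate]
  obtain ⟨m, rfl⟩ : ∃ m, n = m + 1 := ⟨n - 1, by omega⟩
  have : (m ! : ℝ) ≠ 0 := by positivity
  simp [Nat.factorial_succ]
  field_simp

theorem curv_two_of_radial (hn : 1 < n) (hg : gradient u x = f • x)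
    (hlt : (f * ‖x‖) ^ 2 < 1)
    (hh : hessian u x = f • (1 : Matrix (Fin n) (Fin n) ℝ) + b • Matrix.vecMulVec x x) :
    curv 2 u x = f / √(1 - (f * ‖x‖) ^ 2) *
      (2 * ((f + b * ‖x‖ ^ 2) / √(1 - (f * ‖x‖) ^ 2) ^ 3) +
        (n - 2) * (f / √(1 - (f * ‖x‖) ^ 2))) / n := by
  rw [curv, principalCurvatures_of_radial (by omega) hg hlt hh, esymm_two_cons_replicate]
  generalize (f + b * ‖x‖ ^ 2) / √(1 - (f * ‖x‖) ^ 2) ^ 3 = c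
  generalize f / √(1 - (f * ‖x‖) ^ 2) = a
  obtain ⟨m, rfl⟩ : ∃ m, n = m + 2 := ⟨n - 2, by omega⟩
  have : (m ! : ℝ) ≠ 0 := by positivity
  simp [Nat.factorial_succ]
  field_simp
  ring

end ScalarSoliton

/-! ### Calculus of radial functions and radial vector fields -/

namespace ScalarSoliton

section RadialCalculus

variable {E : Type*} [NormedAddCommGroup E] [InnerProductSpace ℝ E]

theorem hasFDerivAt_norm_of_ne_zero {x : E} (hx : x ≠ 0) :
    HasFDerivAt (fun z : E => ‖z‖) (‖x‖⁻¹ • innerSL ℝ x) x := by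
  have h := (hasStrictFDerivAt_norm_sq x).hasFDerivAt.sqrt (by positivity)
  simp only [Real.sqrt_sq (norm_nonneg _)] at h
  convert! h using 1
  ext y
  simp only [smul_apply, smul_eq_mul, nsmul_eq_mul]
  push_cast
  field_simp

/-- The derivative at `x` of a radial vector field `z ↦ F ‖z‖ • z` has the form
`f • id + b • ⟪x, ·⟫ x`. -/
noncomputable def radialDeriv (f b : ℝ) (x : E) : E →L[ℝ] E :=
  f • ContinuousLinearMap.id ℝ E + b • (innerSL ℝ x).smulRight x

theorem radialDeriv_apply (f b : ℝ) (x y : E) :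
    radialDeriv f b x y = f • y + (b * inner ℝ x y) • x := by
  simp [radialDeriv, smul_smul]

theorem hasFDerivAt_radial_field {F : ℝ → ℝ} {F' : ℝ} {x : E} (hx : x ≠ 0)
    (hF : HasDerivAt F F' ‖x‖) :
    HasFDerivAt (fun z : E => F ‖z‖ • z) (radialDeriv (F ‖x‖) (F' / ‖x‖) x) x := by
  have h := (hF.comp_hasFDerivAt x (hasFDerivAt_norm_of_ne_zero hx)).smul (hasFDerivAt_id x)
  convert! h using 1
  ext y
  simp [radialDeriv, smul_smul, div_eq_mul_inv]

/-- The remainder `(F ‖z‖ - F 0) • z` is o(‖z‖), so continuity of `F` at 0 suffices. The coefficient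
`b` is free because the rank-one term vanishes at the origin; one formula then serves all points. -/
theorem hasFDerivAt_radial_field_zero {F : ℝ → ℝ} (hF : ContinuousAt F 0) (b : ℝ) :
    HasFDerivAt (fun z : E => F ‖z‖ • z) (radialDeriv (F 0) b (0 : E)) 0 := by
  rw [hasFDerivAt_iff_isLittleO_nhds_zero]
  have h : Tendsto (fun z : E => F ‖z‖ - F 0) (𝓝 0) (𝓝 0) := by
    have : Tendsto (fun z : E => ‖z‖) (𝓝 0) (𝓝 0) := by
      simpa using (continuous_norm (E := E)).tendsto 0
    simpa using (hF.tendsto.comp this).sub_const (F 0)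
  have h2 : (fun z : E => (F ‖z‖ - F 0) • z) =o[𝓝 0] fun z : E => (1 : ℝ) • z :=
    ((isLittleO_one_iff ℝ).2 h).smul_isBigO (isBigO_refl _ _)
  simpa [radialDeriv, sub_smul] using h2

theorem hasGradientAt_comp_norm [CompleteSpace E] {g : ℝ → ℝ} {p : ℝ} {x : E} (hx : x ≠ 0)
    (hg : HasDerivAt g p ‖x‖) : HasGradientAt (fun z : E => g ‖z‖) ((p / ‖x‖) • x) x := by
  rw [hasGradientAt_iff_hasFDerivAt]
  convert! hg.comp_hasFDerivAt x (hasFDerivAt_norm_of_ne_zero hx) using 1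
  ext y
  simp [div_eq_mul_inv, mul_assoc]

theorem hasGradientAt_comp_norm_zero [CompleteSpace E] {g : ℝ → ℝ}
    (hg : HasDerivAt g 0 0) : HasGradientAt (fun z : E => g ‖z‖) 0 0 := by
  rw [hasGradientAt_iff_hasFDerivAt, hasFDerivAt_iff_isLittleO_nhds_zero]
  have h := hasDerivAt_iff_isLittleO_nhds_zero.1 hg
  have h' : Tendsto (fun z : E => ‖z‖) (𝓝 0) (𝓝 0) := by
    simpa using (continuous_norm (E := E)).tendsto 0
  have h2 := h.comp_tendsto h'
  exact isLittleO_norm_right.1 (by simpa [Function.comp_def] using h2)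

/-- Only the origin matters: the rank-one term has operator norm |r F'(r)| with r = ‖x‖, so r F'(r)
→ 0 is enough and `F'` may be unbounded near 0. -/
theorem continuous_radialDeriv {F F' : ℝ → ℝ} (hF : Continuous F) (hF' : ContinuousOn F' (Ioi 0))
    (h0 : Tendsto (fun r => r * F' r) (𝓝[>] 0) (𝓝 0)) :
    Continuous fun x : E => radialDeriv (F ‖x‖) (F' ‖x‖ / ‖x‖) x := by
  unfold radialDeriv
  refine ((hF.comp continuous_norm).smul continuous_const).add ?_
  rw [continuous_iff_continuousAt]
  intro x
  have hn : ∀ x : E, ‖(F' ‖x‖ / ‖x‖) • (innerSL ℝ x).smulRight x‖ = |‖x‖ * F' ‖x‖| := by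
    intro x
    rw [norm_smul, ContinuousLinearMap.norm_smulRight_apply, innerSL_apply_norm, Real.norm_eq_abs,
      abs_div, abs_mul, abs_norm]
    rcases eq_or_ne x 0 with rfl | hx
    · simp
    · have := norm_pos_iff.2 hx
      field_simp
  rcases eq_or_ne x 0 with rfl | hx
  · have : Tendsto (fun x : E => ‖x‖ * F' ‖x‖) (𝓝 0) (𝓝 0) := by
      rw [← nhdsNE_sup_pure, tendsto_sup]
      refine ⟨h0.comp ?_, tendsto_pure_left.2 fun s hs => by simpa using mem_of_mem_nhds hs⟩
      exact tendsto_norm_nhdsNE_zero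
    rw [ContinuousAt, tendsto_iff_norm_sub_tendsto_zero]
    simpa [hn] using this.abs
  · have hx' := norm_pos_iff.2 hx
    have hc : ContinuousAt (fun x : E => F' ‖x‖) x :=
      ContinuousAt.comp (f := fun x : E => ‖x‖) (hF'.continuousAt (Ioi_mem_nhds hx'))
        continuous_norm.continuousAt
    refine (hc.div continuous_norm.continuousAt hx'.ne').smul ?_
    have : Continuous fun x : E => (innerSL ℝ x).smulRight x := by
      have h := ((ContinuousLinearMap.smulRightL ℝ E E).continuous.comp
        (innerSL ℝ (E := E)).continuous).clm_apply continuous_id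
      exact h
    exact this.continuousAt

end RadialCalculus

variable {n : ℕ}

theorem hessian_of_hasFDerivAt {u : EuclideanSpace ℝ (Fin n) → ℝ} {x : EuclideanSpace ℝ (Fin n)}
    {f b : ℝ} (h : HasFDerivAt (gradient u) (radialDeriv f b x) x) :
    hessian u x = f • (1 : Matrix (Fin n) (Fin n) ℝ) + b • Matrix.vecMulVec x x := by
  ext i j
  simp only [hessian, Matrix.of_apply, h.fderiv, radialDeriv_apply, Matrix.add_apply,
    Matrix.smul_apply, Matrix.one_apply, Matrix.vecMulVec_apply, PiLp.add_apply, PiLp.smul_apply,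
    smul_eq_mul, EuclideanSpace.inner_single_right, PiLp.single_apply]
  simp
  ring

/-- The radial function whose gradient is the radial field `x ↦ f ‖x‖ • x`. -/
noncomputable def radialPotential (f : ℝ → ℝ) (x : EuclideanSpace ℝ (Fin n)) : ℝ :=
  ∫ s in (0 : ℝ)..‖x‖, s * f s

theorem hasDerivAt_integral_mul_self {f : ℝ → ℝ} (hf : Continuous f) (r : ℝ) :
    HasDerivAt (fun r => ∫ s in (0 : ℝ)..r, s * f s) (r * f r) r :=
  (continuous_id.mul hf).integral_hasStrictDerivAt 0 r |>.hasDerivAt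

theorem radial_radialPotential (f : ℝ → ℝ) : Radial (radialPotential (n := n) f) := by
  intro x y h
  rw [radialPotential, radialPotential, h]

theorem hasGradientAt_radialPotential {f : ℝ → ℝ} (hf : Continuous f)
    (x : EuclideanSpace ℝ (Fin n)) : HasGradientAt (radialPotential f) (f ‖x‖ • x) x := by
  rcases eq_or_ne x 0 with rfl | hx
  · have h := hasGradientAt_comp_norm_zero (E := EuclideanSpace ℝ (Fin n))
      (g := fun r => ∫ s in (0 : ℝ)..r, s * f s)
      (by simpa using hasDerivAt_integral_mul_self hf 0)
    simpa using! h
  · have h := hasGradientAt_comp_norm hx (hasDerivAt_integral_mul_self hf ‖x‖)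
    rwa [mul_div_cancel_left₀ _ (norm_ne_zero_iff.2 hx)] at h

theorem gradient_radialPotential {f : ℝ → ℝ} (hf : Continuous f) :
    gradient (radialPotential (n := n) f) = fun x => f ‖x‖ • x :=
  funext fun x => (hasGradientAt_radialPotential hf x).gradient

theorem hasFDerivAt_gradient_radialPotential {f f' : ℝ → ℝ} (hf : Continuous f)
    (hf' : ∀ r, 0 < r → HasDerivAt f (f' r) r) (x : EuclideanSpace ℝ (Fin n)) :
    HasFDerivAt (gradient (radialPotential f)) (radialDeriv (f ‖x‖) (f' ‖x‖ / ‖x‖) x) x := by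
  rw [gradient_radialPotential hf]
  rcases eq_or_ne x 0 with rfl | hx
  · simpa using hasFDerivAt_radial_field_zero (E := EuclideanSpace ℝ (Fin n)) hf.continuousAt
      (f' 0 / 0)
  · exact hasFDerivAt_radial_field hx (hf' _ (norm_pos_iff.2 hx))

theorem contDiff_two_radialPotential {f f' : ℝ → ℝ} (hf : Continuous f)
    (hf' : ∀ r, 0 < r → HasDerivAt f (f' r) r) (hc : ContinuousOn f' (Ioi 0))
    (h0 : Tendsto (fun r => r * f' r) (𝓝[>] 0) (𝓝 0)) :
    ContDiff ℝ 2 (radialPotential (n := n) f) := by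
  have hd := hasFDerivAt_gradient_radialPotential (n := n) hf hf'
  have h1 : ContDiff ℝ 1 (gradient (radialPotential (n := n) f)) := by
    rw [contDiff_one_iff_fderiv]
    refine ⟨fun x => (hd x).differentiableAt, ?_⟩
    rw [show fderiv ℝ (gradient (radialPotential (n := n) f)) = _ from
      funext fun x => (hd x).fderiv]
    exact continuous_radialDeriv hf hc h0
  rw [show (2 : WithTop ℕ∞) = 1 + 1 by norm_num, contDiff_succ_iff_fderiv]
  refine ⟨fun x => (hasGradientAt_radialPotential hf x).differentiableAt, by simp, ?_⟩
  rw [← toDual_comp_gradient]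
  exact (InnerProductSpace.toDual ℝ (EuclideanSpace ℝ (Fin n))).contDiff.comp h1

end ScalarSoliton

/-! ### Integral form of the profile equation and Picard iteration -/

namespace ScalarSoliton

/-- The square of the positive part of `h r - √(1 + y⁺)`. -/
noncomputable def source (h : ℝ → ℝ) (r y : ℝ) : ℝ := (max (h r - √(1 + max y 0)) 0) ^ 2

variable {h : ℝ → ℝ} {C : ℝ}

theorem source_nonneg (r y : ℝ) : 0 ≤ source h r y := sq_nonneg _

theorem continuous_source (hc : Continuous h) : Continuous fun p : ℝ × ℝ => source h p.1 p.2 := by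
  unfold source; fun_prop

theorem source_base_le (hC : ∀ r, h r ≤ C) (hC0 : 0 ≤ C) (r y : ℝ) :
    max (h r - √(1 + max y 0)) 0 ≤ C :=
  max_le (by linarith [hC r, Real.sqrt_nonneg (1 + max y 0)]) hC0

theorem source_le (hC : ∀ r, h r ≤ C) (hC0 : 0 ≤ C) (r y : ℝ) : source h r y ≤ C ^ 2 :=
  pow_le_pow_left₀ (le_max_right _ _) (source_base_le hC hC0 r y) 2

theorem abs_sqrt_one_add_sub_le {a b : ℝ} (ha : 0 ≤ a) (hb : 0 ≤ b) :
    |√(1 + a) - √(1 + b)| ≤ |a - b| / 2 := by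
  have h1 : 1 ≤ √(1 + a) := Real.one_le_sqrt.2 (by linarith)
  have h2 : 1 ≤ √(1 + b) := Real.one_le_sqrt.2 (by linarith)
  have h3 : a - b = (√(1 + a) - √(1 + b)) * (√(1 + a) + √(1 + b)) := by
    linear_combination Real.sq_sqrt (show 0 ≤ 1 + b by linarith) -
      Real.sq_sqrt (show 0 ≤ 1 + a by linarith)
  rw [h3, abs_mul, abs_of_pos (by linarith : 0 < √(1 + a) + √(1 + b))]
  nlinarith [abs_nonneg (√(1 + a) - √(1 + b))]

/-- In a difference of squares the two bases add up to at most 2C, and √(1+t) is 1/2-Lipschitz for t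
≥ 0. -/
theorem abs_source_sub_le (hC : ∀ r, h r ≤ C) (hC0 : 0 ≤ C) (r y z : ℝ) :
    |source h r y - source h r z| ≤ C * |y - z| := by
  have h1 : |max (h r - √(1 + max y 0)) 0 - max (h r - √(1 + max z 0)) 0| ≤ |y - z| / 2 := by
    refine (abs_max_sub_max_le_abs _ _ _).trans ?_
    rw [sub_sub_sub_cancel_left]
    refine (abs_sqrt_one_add_sub_le (le_max_right _ _) (le_max_right _ _)).trans ?_
    rw [abs_sub_comm y z]
    linarith [abs_max_sub_max_le_abs z y 0]
  have h2 := source_base_le hC hC0 r y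
  have h3 := source_base_le hC hC0 r z
  have h4 := le_max_right (h r - √(1 + max y 0)) 0
  have h5 := le_max_right (h r - √(1 + max z 0)) 0
  rw [source, source, sq_sub_sq, abs_mul, abs_of_nonneg (add_nonneg h4 h5)]
  nlinarith [abs_nonneg (max (h r - √(1 + max y 0)) 0 - max (h r - √(1 + max z 0)) 0),
    abs_nonneg (y - z)]

/-- The averaged source, which determines the quotient `y / r ^ 2` of a solution. -/
noncomputable def avgSource (n : ℕ) (h y : ℝ → ℝ) (r : ℝ) : ℝ :=
  ∫ t in (0 : ℝ)..1, n * t ^ (n - 1) * source h (r * t) (y (r * t))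

theorem continuous_avgSource (n : ℕ) (hc : Continuous h) {y : ℝ → ℝ} (hy : Continuous y) :
    Continuous (avgSource n h y) := by
  unfold avgSource
  refine intervalIntegral.continuous_parametric_intervalIntegral_of_continuous'
    (f := fun r t : ℝ => n * t ^ (n - 1) * source h (r * t) (y (r * t))) ?_ 0 1
  have := (continuous_source hc).comp
    (show Continuous fun p : ℝ × ℝ => (p.1 * p.2, y (p.1 * p.2)) by fun_prop)
  simp only [Function.comp_def] at this
  simp only [Function.uncurry_def]
  fun_prop

theorem continuous_avgSource_integrand (n : ℕ) (hc : Continuous h) {y : ℝ → ℝ} (hy : Continuous y)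
    (r : ℝ) : Continuous fun t : ℝ => n * t ^ (n - 1) * source h (r * t) (y (r * t)) := by
  have := (continuous_source hc).comp
    (show Continuous fun t : ℝ => (r * t, y (r * t)) by fun_prop)
  simp only [Function.comp_def] at this
  fun_prop

theorem avgSource_nonneg (n : ℕ) (y : ℝ → ℝ) (r : ℝ) : 0 ≤ avgSource n h y r :=
  intervalIntegral.integral_nonneg zero_le_one fun _ ht =>
    mul_nonneg (mul_nonneg n.cast_nonneg (pow_nonneg ht.1 _)) (source_nonneg _ _)

theorem integral_natCast_mul_pow {n : ℕ} (hn : 0 < n) :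
    ∫ t in (0 : ℝ)..1, (n : ℝ) * t ^ (n - 1) = 1 := by
  obtain ⟨m, rfl⟩ : ∃ m, n = m + 1 := ⟨n - 1, by omega⟩
  rw [intervalIntegral.integral_const_mul, Nat.add_sub_cancel, integral_pow]
  have : (m : ℝ) + 1 ≠ 0 := by positivity
  simp
  field_simp

theorem avgSource_le {n : ℕ} (hn : 0 < n) (hc : Continuous h) (hC : ∀ r, h r ≤ C) (hC0 : 0 ≤ C)
    {y : ℝ → ℝ} (hy : Continuous y) (r : ℝ) : avgSource n h y r ≤ C ^ 2 := by
  have : avgSource n h y r ≤ ∫ t in (0 : ℝ)..1, (n : ℝ) * t ^ (n - 1) * C ^ 2 := by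
    refine intervalIntegral.integral_mono_on zero_le_one
      ((continuous_avgSource_integrand n hc hy r).intervalIntegrable _ _)
      ((by fun_prop : Continuous fun t : ℝ => (n : ℝ) * t ^ (n - 1) * C ^ 2).intervalIntegrable _ _)
      fun t ht => ?_
    exact mul_le_mul_of_nonneg_left (source_le hC hC0 _ _)
      (mul_nonneg n.cast_nonneg (pow_nonneg ht.1 _))
  rwa [intervalIntegral.integral_mul_const, integral_natCast_mul_pow hn, one_mul] at this

theorem avgSource_zero {n : ℕ} (hn : 0 < n) (y : ℝ → ℝ) :
    avgSource n h y 0 = source h 0 (y 0) := by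
  simp [avgSource, -intervalIntegral.integral_const_mul, intervalIntegral.integral_mul_const,
    integral_natCast_mul_pow hn]

/-- By the Lipschitz bound and t^(n-1) ≤ t, r² times the difference of the integrands is at most the
t-derivative of (d/2) exp(nCr²t²). The rate nC of the weight is what yields the contraction factor
1/2. -/
theorem sq_mul_abs_avgSource_sub_le {n : ℕ} (hn : 1 < n) (hc : Continuous h) (hC : ∀ r, h r ≤ C)
    (hC0 : 0 ≤ C) {y z : ℝ → ℝ} (hy : Continuous y) (hz : Continuous z) {d : ℝ}
    (hyz : ∀ r, |y r - z r| ≤ Real.exp (n * C * r ^ 2) * d) (r : ℝ) :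
    r ^ 2 * |avgSource n h y r - avgSource n h z r| ≤
      d / 2 * (Real.exp (n * C * r ^ 2) - 1) := by
  have hd : 0 ≤ d := by simpa using (abs_nonneg _).trans (hyz 0)
  have hG : ∀ t ∈ Ioc (0 : ℝ) 1, ‖r ^ 2 * (n * t ^ (n - 1) * source h (r * t) (y (r * t)) -
      n * t ^ (n - 1) * source h (r * t) (z (r * t)))‖ ≤
      d / 2 * (Real.exp (n * C * r ^ 2 * t ^ 2) * (n * C * r ^ 2 * (2 * t))) := by
    intro t ht
    have h1 := (abs_source_sub_le hC hC0 (r * t) (y (r * t)) (z (r * t))).trans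
      (mul_le_mul_of_nonneg_left (hyz (r * t)) hC0)
    have h2 : t ^ (n - 1) ≤ t := pow_le_of_le_one ht.1.le ht.2 (by omega)
    have h3 : (0 : ℝ) ≤ t ^ (n - 1) := pow_nonneg ht.1.le _
    have h4 : 0 ≤ n * t := mul_nonneg n.cast_nonneg ht.1.le
    rw [← mul_sub, norm_mul, norm_mul, norm_mul, Real.norm_of_nonneg (sq_nonneg r),
      Real.norm_of_nonneg (n.cast_nonneg (α := ℝ)), Real.norm_of_nonneg h3, Real.norm_eq_abs]
    calc r ^ 2 * (n * t ^ (n - 1) * |source h (r * t) (y (r * t)) - source h (r * t) (z (r * t))|)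
        ≤ r ^ 2 * (n * t * (C * (Real.exp (n * C * (r * t) ^ 2) * d))) := by gcongr
      _ = _ := by rw [mul_pow]; ring_nf
  have hI : ∫ t in (0 : ℝ)..1,
      d / 2 * (Real.exp (n * C * r ^ 2 * t ^ 2) * (n * C * r ^ 2 * (2 * t))) =
      d / 2 * (Real.exp (n * C * r ^ 2) - 1) := by
    rw [intervalIntegral.integral_eq_sub_of_hasDerivAt
      (f := fun t => d / 2 * Real.exp (n * C * r ^ 2 * t ^ 2))]
    · simp; ring
    · intro t _
      have := ((((hasDerivAt_id t).pow 2).const_mul (n * C * r ^ 2)).exp).const_mul (d / 2)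
      simpa using! this
    · exact (by fun_prop : Continuous fun t : ℝ => d / 2 * (Real.exp (n * C * r ^ 2 * t ^ 2) *
        (n * C * r ^ 2 * (2 * t)))).intervalIntegrable _ _
  have := intervalIntegral.norm_integral_le_of_norm_le zero_le_one
    (Eventually.of_forall hG)
    ((by fun_prop : Continuous fun t : ℝ => d / 2 * (Real.exp (n * C * r ^ 2 * t ^ 2) *
        (n * C * r ^ 2 * (2 * t)))).intervalIntegrable (μ := MeasureTheory.volume) _ _)
  rwa [hI, intervalIntegral.integral_const_mul, intervalIntegral.integral_sub
    ((continuous_avgSource_integrand n hc hy r).intervalIntegrable _ _)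
    ((continuous_avgSource_integrand n hc hz r).intervalIntegrable _ _), norm_mul,
    Real.norm_of_nonneg (sq_nonneg r), Real.norm_eq_abs] at this

/-- The Picard operator of the profile equation in a Gaussian weighted space. -/
noncomputable def picard {n : ℕ} (hn : 1 < n) (hc : Continuous h) (hC : ∀ r, h r ≤ C)
    (hC0 : 0 < C) (v : BoundedContinuousFunction ℝ ℝ) : BoundedContinuousFunction ℝ ℝ :=
  BoundedContinuousFunction.ofNormedAddCommGroup
    (fun r => Real.exp (-(n * C * r ^ 2)) *
      (r ^ 2 * avgSource n h (fun s => Real.exp (n * C * s ^ 2) * v s) r))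
    (by
      have := continuous_avgSource n hc (y := fun s => Real.exp (n * C * s ^ 2) * v s)
        (by fun_prop)
      fun_prop)
    (C ^ 2 / (n * C))
    (by
      intro r
      have h1 := avgSource_le (by omega : 0 < n) hc hC hC0.le
        (y := fun s => Real.exp (n * C * s ^ 2) * v s) (by fun_prop) r
      have h2 := avgSource_nonneg (h := h) n (fun s => Real.exp (n * C * s ^ 2) * v s) r
      have hn0 : (0 : ℝ) < n := by exact_mod_cast (by omega : 0 < n)
      rw [Real.norm_of_nonneg (by positivity), Real.exp_neg, inv_mul_le_iff₀ (Real.exp_pos _),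
        mul_div_assoc', le_div_iff₀ (by positivity)]
      have h3 := Real.add_one_le_exp (n * C * r ^ 2)
      calc _ = (n * C * r ^ 2) * avgSource n h (fun s => Real.exp (n * C * s ^ 2) * v s) r := by ring
        _ ≤ Real.exp (n * C * r ^ 2) * C ^ 2 := by gcongr; linarith)

theorem contractingWith_picard {n : ℕ} (hn : 1 < n) (hc : Continuous h) (hC : ∀ r, h r ≤ C)
    (hC0 : 0 < C) : ContractingWith (1 / 2) (picard hn hc hC hC0) := by
  refine ⟨by norm_num, LipschitzWith.of_dist_le_mul fun v w => ?_⟩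
  rw [BoundedContinuousFunction.dist_le (mul_nonneg (by norm_num) dist_nonneg)]
  intro r
  have := sq_mul_abs_avgSource_sub_le hn hc hC hC0.le
    (y := fun s => Real.exp (n * C * s ^ 2) * v s) (z := fun s => Real.exp (n * C * s ^ 2) * w s)
    (by fun_prop) (by fun_prop) (d := dist v w)
    (fun s => by
      rw [← mul_sub, abs_mul, abs_of_pos (Real.exp_pos _)]
      gcongr
      exact BoundedContinuousFunction.dist_coe_le_dist (f := v) (g := w) s) r
  simp only [picard, BoundedContinuousFunction.coe_ofNormedAddCommGroup]
  rw [Real.dist_eq, ← mul_sub, ← mul_sub, abs_mul, abs_mul, abs_of_pos (Real.exp_pos _),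
    abs_of_nonneg (sq_nonneg r), Real.exp_neg, inv_mul_le_iff₀ (Real.exp_pos _)]
  refine this.trans ?_
  push_cast
  nlinarith [dist_nonneg (x := v) (y := w), Real.exp_pos (n * C * r ^ 2)]

theorem exists_integral_solution {n : ℕ} (hn : 1 < n) (hc : Continuous h) (hC : ∀ r, h r ≤ C)
    (hC0 : 0 < C) : ∃ y : ℝ → ℝ, Continuous y ∧ ∀ r, y r = r ^ 2 * avgSource n h y r := by
  have hk := contractingWith_picard hn hc hC hC0
  set v := ContractingWith.fixedPoint (picard hn hc hC hC0) hk
  refine ⟨fun s => Real.exp (n * C * s ^ 2) * v s, by fun_prop, fun r => ?_⟩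
  have hv : picard hn hc hC hC0 v = v := hk.fixedPoint_isFixedPt
  have := congrArg (fun w : BoundedContinuousFunction ℝ ℝ => w r) hv
  simp only [picard, BoundedContinuousFunction.coe_ofNormedAddCommGroup] at this
  simp only
  rw [← this, ← mul_assoc, ← Real.exp_add]
  simp

/-- The substitution s = rt turns the parametric integral into a primitive, to which the fundamental
theorem of calculus applies. -/
theorem pow_mul_avgSource {n : ℕ} (hn : 0 < n) (y : ℝ → ℝ) (r : ℝ) :
    r ^ n * avgSource n h y r = ∫ s in (0 : ℝ)..r, n * s ^ (n - 1) * source h s (y s) := by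
  have := intervalIntegral.mul_integral_comp_mul_left (a := 0) (b := 1) (c := r)
    (f := fun s => n * s ^ (n - 1) * source h s (y s))
  rw [mul_zero, mul_one] at this
  rw [← this, avgSource, ← intervalIntegral.integral_const_mul,
    ← intervalIntegral.integral_const_mul]
  congr 1
  ext t
  obtain ⟨m, rfl⟩ : ∃ m, n = m + 1 := ⟨n - 1, by omega⟩
  simp only [Nat.add_sub_cancel]
  ring

theorem hasDerivAt_avgSource {n : ℕ} (hn : 0 < n) (hc : Continuous h) {y : ℝ → ℝ}
    (hy : Continuous y) {r : ℝ} (hr : 0 < r) :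
    HasDerivAt (avgSource n h y) (n * (source h r (y r) - avgSource n h y r) / r) r := by
  have hcont : Continuous fun s : ℝ => n * s ^ (n - 1) * source h s (y s) := by
    simpa using continuous_avgSource_integrand n hc hy 1
  have h1 := (hcont.integral_hasStrictDerivAt 0 r).hasDerivAt
  have h2 := h1.div (hasDerivAt_pow n r) (by positivity)
  have h3 := h2.congr_of_eventuallyEq (f₁ := avgSource n h y) (by
    filter_upwards [lt_mem_nhds hr] with s hs
    simp only [Pi.div_apply]
    rw [← pow_mul_avgSource hn, mul_div_cancel_left₀ _ (by positivity)])
  convert! h3 using 1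
  rw [← pow_mul_avgSource hn]
  obtain ⟨m, rfl⟩ : ∃ m, n = m + 1 := ⟨n - 1, by omega⟩
  simp only [Nat.add_sub_cancel]
  field_simp
  ring

end ScalarSoliton

/-! ### The convexity barrier and uniqueness of the profile -/

namespace ScalarSoliton

/-- `Q = (w / r) ^ 2` for the rapidity `w` of an increasing convex radial soliton. -/
structure IsProfile (n : ℕ) (h Q : ℝ → ℝ) : Prop where
  continuous : Continuous Q
  zero : Q 0 = (h 0 - 1) ^ 2
  pos : ∀ r, 0 ≤ r → 0 < Q r
  sqrt_lt : ∀ r, 0 ≤ r → √(1 + r ^ 2 * Q r) < h r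
  convex : ∀ r, 0 ≤ r → (n - 2) * Q r < n * (h r - √(1 + r ^ 2 * Q r)) ^ 2
  hasDerivAt : ∀ r, 0 < r → HasDerivAt Q (n * ((h r - √(1 + r ^ 2 * Q r)) ^ 2 - Q r) / r) r

theorem eventually_neg_left_of_deriv_pos {g : ℝ → ℝ} {g' a : ℝ} (hg : HasDerivAt g g' a)
    (ha : g a = 0) (hg' : 0 < g') : ∀ᶠ r in 𝓝[<] a, g r < 0 := by
  have h := (hasDerivAt_iff_tendsto_slope.1 hg).mono_left (nhdsLT_le_nhdsNE a)
  filter_upwards [h.eventually (lt_mem_nhds hg'), self_mem_nhdsWithin] with r hr hra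
  rw [slope_def_field, ha, sub_zero] at hr
  have hra' : r - a < 0 := sub_neg.2 hra
  by_contra! hc
  exact absurd hr (not_lt.2 (div_nonpos_of_nonneg_of_nonpos hc hra'.le))

theorem exists_first_nonpos {d : ℝ → ℝ} (hd : Continuous d) (h0 : 0 < d 0) {b : ℝ} (hb : 0 ≤ b)
    (hdb : d b ≤ 0) : ∃ a, 0 < a ∧ d a = 0 ∧ ∀ r, 0 ≤ r → r < a → 0 < d r := by
  set S : Set ℝ := {r | 0 ≤ r ∧ d r ≤ 0}
  have hS : IsClosed S := (isClosed_le continuous_const continuous_id).inter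
    (isClosed_le hd continuous_const)
  have hbd : BddBelow S := ⟨0, fun r hr => hr.1⟩
  obtain ⟨ha0, hda⟩ : sInf S ∈ S := hS.csInf_mem ⟨b, hb, hdb⟩ hbd
  have hpos : 0 < sInf S := ha0.lt_of_ne fun h => by rw [← h] at hda; linarith
  have hlt : ∀ r, 0 ≤ r → r < sInf S → 0 < d r := fun r hr hra => by
    by_contra! hc
    exact absurd (csInf_le hbd ⟨hr, hc⟩) (not_le.2 hra)
  refine ⟨sInf S, hpos, le_antisymm hda ?_, hlt⟩
  have ht : Tendsto d (𝓝[<] sInf S) (𝓝 (d (sInf S))) := hd.continuousAt.mono_left nhdsWithin_le_nhds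
  refine ge_of_tendsto ht ?_
  filter_upwards [self_mem_nhdsWithin, mem_nhdsWithin_of_mem_nhds (lt_mem_nhds hpos)] with r hr hr0
  exact (hlt r (le_of_lt hr0) hr).le

/-- A first-contact argument for the truncated solution: the barrier α(h - √(1+y)) - √Q > 0 gives
`sqrt_lt` and `convex` together, and it removes the positive part from the equation. -/
theorem exists_isProfile {n : ℕ} (hn : 2 < n) {h : ℝ → ℝ} {C : ℝ} (hc : Continuous h)
    (hC : ∀ r, h r ≤ C) (h0 : 1 < h 0) (hmono : MonotoneOn h (Ici 0)) :
    ∃ Q, IsProfile n h Q := by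
  have hC0 : 0 < C := by linarith [hC 0]
  obtain ⟨y, hy, hyeq⟩ := exists_integral_solution (by omega : 1 < n) hc hC hC0
  set Q := avgSource n h y with hQ
  have hQc : Continuous Q := continuous_avgSource n hc hy
  have hQ0 : ∀ r, 0 ≤ Q r := avgSource_nonneg n y
  have hn2 : (0 : ℝ) < n - 2 := by
    have : (2 : ℝ) < n := by exact_mod_cast hn
    linarith
  have hn0 : (0 : ℝ) < n := by linarith
  have hsrc : ∀ r, source h r (y r) = (max (h r - √(1 + r ^ 2 * Q r)) 0) ^ 2 := fun r => by
    rw [source, hyeq, max_eq_left (mul_nonneg (sq_nonneg r) (hQ0 r))]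
  have hQz : Q 0 = (h 0 - 1) ^ 2 := by
    rw [hQ, avgSource_zero (by omega), hsrc]
    simp [h0.le]
  -- This is the constant for which equality in the barrier means y' = 0. As α > 1, the barrier
  -- starts at (α-1)(h 0 - 1) > 0.
  set α := √(n / (n - 2)) with hα
  have hα2 : α ^ 2 = n / (n - 2) := Real.sq_sqrt (by positivity)
  have hα1 : 1 < α := by
    rw [hα, Real.lt_sqrt zero_le_one, one_pow, one_lt_div hn2]
    linarith
  have hd : ∀ r, 0 ≤ r → 0 < α * (h r - √(1 + r ^ 2 * Q r)) - √(Q r) := by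
    intro b hb
    by_contra! hdb
    obtain ⟨a, ha, hda, hlt⟩ := exists_first_nonpos
      (d := fun r => α * (h r - √(1 + r ^ 2 * Q r)) - √(Q r)) (by fun_prop)
      (by
        simp only [hQz, Real.sqrt_sq (by linarith : 0 ≤ h 0 - 1)]
        norm_num
        nlinarith) hb hdb
    have hha : 1 < h a := h0.trans_le (hmono self_mem_Ici ha.le ha.le)
    have hQa : 0 < Q a := by
      refine (hQ0 a).lt_of_ne fun hz => ?_
      rw [← hz] at hda
      norm_num at hda
      rcases hda with hda | hda <;> linarith
    have hsQ := Real.sqrt_pos.2 hQa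
    have hE : 0 < h a - √(1 + a ^ 2 * Q a) := by
      by_contra! hneg
      nlinarith
    have hE2 : (h a - √(1 + a ^ 2 * Q a)) ^ 2 = (n - 2) / n * Q a := by
      have h1 : (α * (h a - √(1 + a ^ 2 * Q a))) ^ 2 = √(Q a) ^ 2 := by
        rw [sub_eq_zero.1 hda]
      rw [mul_pow, hα2, Real.sq_sqrt hQa.le] at h1
      field_simp at h1 ⊢
      linarith
    -- At the contact point the source is (n-2)/n · Q, so Q' = -2Q/a and y = r²Q is stationary.
    have hQd : HasDerivAt Q (-2 * Q a / a) a := by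
      convert! hasDerivAt_avgSource (by omega : 0 < n) hc hy ha using 1
      rw [hsrc, max_eq_left hE.le, hE2]
      field_simp
      ring
    have hyd : HasDerivAt (fun r => 1 + r ^ 2 * Q r) 0 a := by
      have := (((hasDerivAt_id a).pow 2).mul hQd).const_add 1
      convert! this using 1
      simp only [id_eq, Pi.pow_apply]
      field_simp
      ring
    -- No differentiability of `h` is available, so its value is frozen at `a`; only the term -√Q
    -- then contributes to the derivative.
    have hgd : HasDerivAt (fun r => α * (h a - √(1 + r ^ 2 * Q r)) - √(Q r)) (√(Q a) / a) a := by
      have hne : 1 + a ^ 2 * Q a ≠ 0 := by positivity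
      have := (((hyd.sqrt hne).const_sub (h a)).const_mul α).sub (hQd.sqrt hQa.ne')
      convert! this using 1
      field_simp
      rw [Real.sq_sqrt hQa.le]
      ring
    have hev := eventually_neg_left_of_deriv_pos hgd hda (by positivity)
    obtain ⟨r, hr, hra, hr0⟩ := (hev.and (eventually_mem_nhdsWithin.and
      (mem_nhdsWithin_of_mem_nhds (lt_mem_nhds ha)))).exists
    have h1 := hlt r (le_of_lt hr0) hra
    -- Since h r ≤ h a, the true barrier lies below the frozen one, which is negative just left of
    -- `a`; this contradicts positivity before the contact.
    have h2 := hmono (le_of_lt hr0 : (0:ℝ) ≤ r) ha.le (le_of_lt hra : r ≤ a)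
    nlinarith
  have hE : ∀ r, 0 ≤ r → 0 < h r - √(1 + r ^ 2 * Q r) := fun r hr => by
    by_contra! hneg
    nlinarith [hd r hr, Real.sqrt_nonneg (Q r)]
  have hpos : ∀ r, 0 ≤ r → 0 < Q r := fun r hr => by
    refine intervalIntegral.intervalIntegral_pos_of_pos_on
      ((continuous_avgSource_integrand n hc hy r).intervalIntegrable _ _) (fun t ht => ?_)
      zero_lt_one
    have ht0 := ht.1
    have := lt_max_of_lt_left (hE (r * t) (by positivity)) (c := 0)
    rw [hsrc]
    positivity
  refine ⟨Q, hQc, hQz, hpos, fun r hr => sub_pos.1 (hE r hr), fun r hr => ?_, fun r hr => ?_⟩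
  · have h1 := hd r hr
    have h2 : √(Q r) ^ 2 < (α * (h r - √(1 + r ^ 2 * Q r))) ^ 2 :=
      pow_lt_pow_left₀ (by linarith) (Real.sqrt_nonneg _) two_ne_zero
    rw [mul_pow, hα2, Real.sq_sqrt (hQ0 r), div_mul_eq_mul_div, lt_div_iff₀ hn2] at h2
    linarith
  · have := hasDerivAt_avgSource (by omega : 0 < n) hc hy hr
    rwa [hsrc, max_eq_left (hE r hr.le).le] at this

/-- The weight r^(n-2) is the integrating factor of the singular term -(n-2)Y/r. Since n > 2 it
vanishes at 0, so no initial value has to be prescribed. -/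
theorem sq_profile_unique {n : ℕ} (hn : 2 < n) {h Y Z : ℝ → ℝ}
    (hYc : ContinuousOn Y (Ici 0)) (hZc : ContinuousOn Z (Ici 0))
    (hY0 : ∀ r, 0 < r → 0 ≤ Y r) (hZ0 : ∀ r, 0 < r → 0 ≤ Z r)
    (hYh : ∀ r, 0 < r → √(1 + Y r) ≤ h r) (hZh : ∀ r, 0 < r → √(1 + Z r) ≤ h r)
    (hYd : ∀ r, 0 < r → HasDerivAt Y (n * r * (h r - √(1 + Y r)) ^ 2 - (n - 2) * Y r / r) r)
    (hZd : ∀ r, 0 < r → HasDerivAt Z (n * r * (h r - √(1 + Z r)) ^ 2 - (n - 2) * Z r / r) r)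
    {r : ℝ} (hr : 0 < r) : Y r = Z r := by
  obtain ⟨k, rfl⟩ : ∃ k, n = k + 3 := ⟨n - 3, by omega⟩
  have hder : ∀ s, 0 < s → HasDerivAt (fun s => (s ^ (k + 1) * (Y s - Z s)) ^ 2)
      (2 * (k + 3) * s ^ (2 * k + 3) * ((Y s - Z s) *
        ((h s - √(1 + Y s)) ^ 2 - (h s - √(1 + Z s)) ^ 2))) s := by
    intro s hs
    have := (((hasDerivAt_pow (k + 1) s).mul ((hYd s hs).sub (hZd s hs)))).pow 2
    convert! this using 1
    simp
    field_simp
    ring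
  have hanti : AntitoneOn (fun s => (s ^ (k + 1) * (Y s - Z s)) ^ 2) (Ici 0) := by
    refine antitoneOn_of_deriv_nonpos (convex_Ici 0)
      (((continuousOn_id.pow _).mul (hYc.sub hZc)).pow 2) (fun s hs => ?_) (fun s hs => ?_)
    · rw [interior_Ici] at hs
      exact (hder s hs).differentiableAt.differentiableWithinAt
    · rw [interior_Ici] at hs
      rw [(hder s hs).deriv]
      have hs0 : (0 : ℝ) < s := hs
      refine mul_nonpos_of_nonneg_of_nonpos (by positivity) ?_
      have e1 := Real.sq_sqrt (by linarith [hY0 s hs] : 0 ≤ 1 + Y s)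
      have e2 := Real.sq_sqrt (by linarith [hZ0 s hs] : 0 ≤ 1 + Z s)
      have e3 := hYh s hs
      have e4 := hZh s hs
      have e5 := Real.sqrt_nonneg (1 + Y s)
      have e6 := Real.sqrt_nonneg (1 + Z s)
      -- Both factors contain √(1+Y) - √(1+Z), with opposite signs as long as √(1+Y) and √(1+Z) stay
      -- below h.
      have : (Y s - Z s) * ((h s - √(1 + Y s)) ^ 2 - (h s - √(1 + Z s)) ^ 2) =
          -((√(1 + Y s) - √(1 + Z s)) ^ 2 * ((√(1 + Y s) + √(1 + Z s)) *
            ((h s - √(1 + Y s)) + (h s - √(1 + Z s))))) := by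
        linear_combination (-((h s - √(1 + Y s)) ^ 2 - (h s - √(1 + Z s)) ^ 2)) * (e1 - e2)
      rw [this, neg_nonpos]
      have := sub_nonneg.2 e3
      have := sub_nonneg.2 e4
      positivity
  have h1 := hanti self_mem_Ici hr.le hr.le
  simp only [zero_pow (Nat.succ_ne_zero k), zero_mul, ne_eq, OfNat.ofNat_ne_zero,
    not_false_eq_true, zero_pow] at h1
  have h2 := pow_eq_zero_iff (two_ne_zero) |>.1 (le_antisymm h1 (sq_nonneg _))
  rcases mul_eq_zero.1 h2 with h3 | h3
  · exact absurd h3 (by positivity)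
  · linarith

namespace IsProfile

variable {n : ℕ} {h Q : ℝ → ℝ}

theorem hasDerivAt_sq_mul (hQ : IsProfile n h Q) {r : ℝ} (hr : 0 < r) :
    HasDerivAt (fun r => r ^ 2 * Q r)
      (n * r * (h r - √(1 + r ^ 2 * Q r)) ^ 2 - (n - 2) * (r ^ 2 * Q r) / r) r := by
  have := ((hasDerivAt_id r).pow 2).mul (hQ.hasDerivAt r hr)
  convert! this using 1
  simp
  field_simp
  ring

/-- The derivative of y is r times the slack in the field `convex`. -/
theorem deriv_sq_mul_pos (hQ : IsProfile n h Q) {r : ℝ} (hr : 0 < r) :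
    0 < n * r * (h r - √(1 + r ^ 2 * Q r)) ^ 2 - (n - 2) * (r ^ 2 * Q r) / r := by
  have := mul_pos hr (sub_pos.2 (hQ.convex r hr.le))
  have h2 : n * r * (h r - √(1 + r ^ 2 * Q r)) ^ 2 - (n - 2) * (r ^ 2 * Q r) / r =
      r * (n * (h r - √(1 + r ^ 2 * Q r)) ^ 2 - (n - 2) * Q r) := by
    field_simp
  rwa [h2]

end IsProfile

end ScalarSoliton

/-! ### Limit of the slope and integrability of the excess -/

namespace ScalarSoliton

/-- The factor `f` for which `f ‖x‖ • x` is the gradient of the soliton with profile `Q`. -/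
noncomputable def gradFactor (Q : ℝ → ℝ) (r : ℝ) : ℝ := √(Q |r| / (1 + r ^ 2 * Q |r|))

namespace IsProfile

variable {n : ℕ} {h Q : ℝ → ℝ} {C : ℝ}

theorem sq_mul_nonneg (hQ : IsProfile n h Q) {r : ℝ} (hr : 0 ≤ r) : 0 ≤ r ^ 2 * Q r :=
  mul_nonneg (sq_nonneg r) (hQ.pos r hr).le

theorem one_add_pos (hQ : IsProfile n h Q) (r : ℝ) : 0 < 1 + r ^ 2 * Q |r| := by
  have := hQ.pos |r| (abs_nonneg r)
  positivity

theorem continuous_gradFactor (hQ : IsProfile n h Q) : Continuous (gradFactor Q) := by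
  have h1 := hQ.continuous
  have h2 := fun r => (hQ.one_add_pos r).ne'
  unfold gradFactor
  fun_prop (disch := assumption)

theorem mul_gradFactor (hQ : IsProfile n h Q) {r : ℝ} (hr : 0 ≤ r) :
    r * gradFactor Q r = √(r ^ 2 * Q r) / √(1 + r ^ 2 * Q r) := by
  rw [gradFactor, abs_of_nonneg hr, Real.sqrt_div (hQ.pos r hr).le, Real.sqrt_mul (sq_nonneg r),
    Real.sqrt_sq hr, mul_div_assoc]

theorem monotoneOn_sq_mul (hQ : IsProfile n h Q) :
    MonotoneOn (fun r => r ^ 2 * Q r) (Ici 0) := by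
  refine monotoneOn_of_deriv_nonneg (convex_Ici 0)
    ((continuous_id.pow 2).mul hQ.continuous).continuousOn (fun r hr => ?_) (fun r hr => ?_) <;>
    rw [interior_Ici] at hr
  · exact (hQ.hasDerivAt_sq_mul hr).differentiableAt.differentiableWithinAt
  · rw [(hQ.hasDerivAt_sq_mul hr).deriv]
    exact (hQ.deriv_sq_mul_pos hr).le

theorem sq_mul_lt (hQ : IsProfile n h Q) (hC : ∀ r, 0 ≤ r → h r ≤ C) {r : ℝ} (hr : 0 ≤ r) :
    r ^ 2 * Q r < C ^ 2 - 1 := by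
  have h1 := (hQ.sqrt_lt r hr).trans_le (hC r hr)
  have h2 := Real.sq_sqrt (by linarith [hQ.sq_mul_nonneg hr] : 0 ≤ 1 + r ^ 2 * Q r)
  nlinarith [Real.sqrt_nonneg (1 + r ^ 2 * Q r)]

/-- If the increasing function y stayed below some L < C²-1, then h - √(1+y) would stay away from 0,
and the term n r (h - √(1+y))² would make y' ≥ 1 eventually. -/
theorem tendsto_sq_mul (hQ : IsProfile n h Q) (hn : 2 < n) (hC : ∀ r, 0 ≤ r → h r ≤ C)
    (hlim : Tendsto h atTop (𝓝 C)) :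
    Tendsto (fun r => r ^ 2 * Q r) atTop (𝓝 (C ^ 2 - 1)) := by
  have hn2 : (2 : ℝ) < n := by exact_mod_cast hn
  have hC1 : 1 < C := by
    have := (hQ.sqrt_lt 0 le_rfl).trans_le (hC 0 le_rfl)
    simpa using this
  refine tendsto_order.2 ⟨fun L hL => ?_, fun L hL => ?_⟩
  swap
  · filter_upwards [eventually_ge_atTop 0] with r hr
    exact (hQ.sq_mul_lt hC hr).trans hL
  by_contra hcon
  have hle : ∀ r, 0 ≤ r → r ^ 2 * Q r ≤ L := fun r hr => by
    by_contra! hlt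
    refine hcon ?_
    filter_upwards [eventually_ge_atTop r] with s hs
    exact hlt.trans_le (hQ.monotoneOn_sq_mul hr (hr.trans hs) hs)
  have hL0 : 0 ≤ L := by simpa using hle 0 le_rfl
  have hWC : √(1 + L) < C := by
    rw [Real.sqrt_lt' (by linarith)]
    linarith
  obtain ⟨m, hm1, hm2⟩ := exists_between hWC
  have hev : ∀ᶠ r in atTop, (1 : ℝ) ≤ n * r * (m - √(1 + L)) ^ 2 - (n - 2) * L / r := by
    have h1 : Tendsto (fun r : ℝ => n * r * (m - √(1 + L)) ^ 2) atTop atTop :=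
      (tendsto_id.const_mul_atTop (by linarith : (0 : ℝ) < n)).atTop_mul_const
        (pow_pos (sub_pos.2 hm1) 2)
    have h2 : Tendsto (fun r : ℝ => (n - 2) * L / r) atTop (𝓝 0) :=
      tendsto_const_nhds.div_atTop tendsto_id
    filter_upwards [h1.eventually_ge_atTop 2, h2.eventually (gt_mem_nhds one_pos)] with r hr1 hr2
    linarith
  obtain ⟨R, hR⟩ := (hev.and ((hlim.eventually (lt_mem_nhds hm2)).and
    (eventually_gt_atTop 0))).exists_forall_of_atTop
  have hR0 := (hR R le_rfl).2.2
  have key : ∀ r, R ≤ r → 1 ≤ deriv (fun r => r ^ 2 * Q r) r := by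
    intro r hr
    obtain ⟨h1, h2, h3⟩ := hR r hr
    rw [(hQ.hasDerivAt_sq_mul h3).deriv]
    have h4 : √(1 + r ^ 2 * Q r) ≤ √(1 + L) := Real.sqrt_le_sqrt (by linarith [hle r h3.le])
    have h5 : (m - √(1 + L)) ^ 2 ≤ (h r - √(1 + r ^ 2 * Q r)) ^ 2 :=
      pow_le_pow_left₀ (by linarith) (by linarith) 2
    have h6 : (n - 2) * (r ^ 2 * Q r) / r ≤ (n - 2) * L / r := by
      have := hle r h3.le
      gcongr
    have h7 : n * r * (m - √(1 + L)) ^ 2 ≤ n * r * (h r - √(1 + r ^ 2 * Q r)) ^ 2 := by gcongr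
    linarith
  -- A slope at least 1 over an interval of length L + 1 carries y beyond L.
  have := (convex_Ici R).mul_sub_le_image_sub_of_le_deriv
    (f := fun r => r ^ 2 * Q r) (C := 1) ((continuous_id.pow 2).mul hQ.continuous).continuousOn
    (fun r hr => by
      rw [interior_Ici] at hr
      exact (hQ.hasDerivAt_sq_mul (hR0.trans hr)).differentiableAt.differentiableWithinAt)
    (fun r hr => by
      rw [interior_Ici] at hr
      exact key r (le_of_lt hr)) R self_mem_Ici (R + L + 1) (by
        show R ≤ R + L + 1
        linarith) (by linarith)
  have h8 := hle (R + L + 1) (by linarith)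
  have h9 := hQ.sq_mul_nonneg hR0.le
  linarith

theorem tendsto_mul_gradFactor (hQ : IsProfile n h Q) (hn : 2 < n) (hC1 : 1 < C)
    (hC : ∀ r, 0 ≤ r → h r ≤ C) (hlim : Tendsto h atTop (𝓝 C)) :
    Tendsto (fun r => r * gradFactor Q r) atTop (𝓝 √(1 - 1 / C ^ 2)) := by
  have h1 := hQ.tendsto_sq_mul hn hC hlim
  have h2 := h1.sqrt.div (h1.const_add 1).sqrt (Real.sqrt_ne_zero'.2 (by nlinarith))
  have h3 : √(C ^ 2 - 1) / √(1 + (C ^ 2 - 1)) = √(1 - 1 / C ^ 2) := by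
    rw [← Real.sqrt_div (by nlinarith)]
    congr 1
    have : C ≠ 0 := by linarith
    field_simp
    ring
  rw [← h3]
  refine h2.congr' ?_
  filter_upwards [eventually_ge_atTop 0] with r hr
  exact (hQ.mul_gradFactor hr).symm

/-- The excess of `h - √(1 + w ^ 2)` over its leading part `√((n - 2) / n) * w / r`. -/
noncomputable def excess (n : ℕ) (h Q : ℝ → ℝ) (r : ℝ) : ℝ :=
  h r - √(1 + r ^ 2 * Q r) - √((n - 2) / n) * √(Q r)

theorem excess_pos (hQ : IsProfile n h Q) (hn : 2 < n) {r : ℝ} (hr : 0 ≤ r) :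
    0 < excess n h Q r := by
  have hn2 : (0 : ℝ) < n - 2 := by
    have : (2 : ℝ) < n := by exact_mod_cast hn
    linarith
  have hn0 : (0 : ℝ) < n := by linarith
  rw [excess, sub_pos, ← Real.sqrt_mul (by positivity), Real.sqrt_lt' (sub_pos.2 (hQ.sqrt_lt r hr)),
    div_mul_eq_mul_div, div_lt_iff₀ hn0, mul_comm _ (n : ℝ)]
  exact hQ.convex r hr

theorem continuous_excess (hQ : IsProfile n h Q) (hh : Continuous h) :
    Continuous (excess n h Q) := by
  have := hQ.continuous
  unfold excess
  fun_prop

/-- The derivative of the bounded increasing function y is integrable, and for r > 1 it is at least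
a positive constant times the excess. -/
theorem integrableOn_excess (hQ : IsProfile n h Q) (hn : 2 < n) (hh : Continuous h)
    (hC : ∀ r, 0 ≤ r → h r ≤ C) (hlim : Tendsto h atTop (𝓝 C)) :
    MeasureTheory.IntegrableOn (excess n h Q) (Ioi 1) := by
  have hn2 : (0 : ℝ) < n - 2 := by
    have : (2 : ℝ) < n := by exact_mod_cast hn
    linarith
  have hn0 : (0 : ℝ) < n := by linarith
  have hβ : 0 < √(((n : ℝ) - 2) / n) := Real.sqrt_pos.2 (by positivity)
  have hQ1 : 0 < √(Q 1) := Real.sqrt_pos.2 (hQ.pos 1 zero_le_one)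
  have hint := MeasureTheory.integrableOn_Ioi_deriv_of_nonneg'
    (fun r (hr : r ∈ Ici (1 : ℝ)) => hQ.hasDerivAt_sq_mul (zero_lt_one.trans_le hr))
    (fun r hr => (hQ.deriv_sq_mul_pos (zero_lt_one.trans hr)).le) (hQ.tendsto_sq_mul hn hC hlim)
  refine (hint.const_mul (2 * n * √(((n : ℝ) - 2) / n) * √(Q 1))⁻¹).mono'
    (hQ.continuous_excess hh).aestronglyMeasurable ?_
  refine (MeasureTheory.ae_restrict_mem measurableSet_Ioi).mono fun r hr => ?_
  have hr1 : (1 : ℝ) < r := hr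
  have hr0 : 0 < r := zero_lt_one.trans hr1
  have he := hQ.excess_pos hn hr0.le
  rw [Real.norm_of_nonneg he.le, inv_mul_eq_div, le_div_iff₀ (by positivity)]
  have hw : √(Q 1) ≤ r * √(Q r) := by
    have := Real.sqrt_le_sqrt (hQ.monotoneOn_sq_mul (mem_Ici.2 zero_le_one) hr0.le hr1.le)
    simpa [Real.sqrt_mul, hr0.le] using this
  have hE : h r - √(1 + r ^ 2 * Q r) = excess n h Q r + √(((n : ℝ) - 2) / n) * √(Q r) := by
    rw [excess]; ring
  have hβ2 : √(((n : ℝ) - 2) / n) ^ 2 = (n - 2) / n := Real.sq_sqrt (by positivity)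
  have hsQ := Real.sq_sqrt (hQ.pos r hr0.le).le
  -- With β = √((n-2)/n) and h - √(1+y) = e + β√Q, the term nrβ²Q cancels (n-2)y/r exactly, and the
  -- cross term is linear in e.
  have hy' : n * r * (h r - √(1 + r ^ 2 * Q r)) ^ 2 - (n - 2) * (r ^ 2 * Q r) / r =
      n * r * excess n h Q r ^ 2 + excess n h Q r *
        (2 * n * √(((n : ℝ) - 2) / n) * (r * √(Q r))) := by
    rw [hE, add_sq, mul_pow, hβ2, hsQ]
    field_simp
    ring
  rw [hy']
  have : excess n h Q r * (2 * n * √(((n : ℝ) - 2) / n) * √(Q 1)) ≤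
    excess n h Q r * (2 * n * √(((n : ℝ) - 2) / n) * (r * √(Q r))) := by gcongr
  have h0 : 0 ≤ n * r * excess n h Q r ^ 2 := by positivity
  linarith

end IsProfile

/-- Expansion of the slope `w / √(1 + w ^ 2)` near the value `√(1 + w ^ 2) = C`. -/
theorem abs_slope_expansion_le {C s w W : ℝ} (hC : 1 < C) (hs : 0 < s) (hsC : s ^ 2 = C ^ 2 - 1)
    (hw : 0 ≤ w) (hW1 : 1 ≤ W) (hW : W ^ 2 = 1 + w ^ 2) (hWC : W ≤ C) :
    0 ≤ s - w ∧ s - w ≤ 2 * C / s * (C - W) ∧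
      |w / W - s / C + (C - W) / (C ^ 2 * s)| ≤
        ((1 + (2 * C / s) ^ 2) / (2 * s) + 1 / (s * C ^ 2)) * (C - W) ^ 2 := by
  have h1 : (s - w) * (s + w) = (C - W) * (C + W) := by linear_combination hsC + hW
  have h0 : 0 ≤ s - w := by
    by_contra! hneg
    nlinarith
  have h2 : s - w ≤ 2 * C / s * (C - W) := by
    rw [div_mul_eq_mul_div, le_div_iff₀ hs]
    nlinarith
  refine ⟨h0, h2, ?_⟩
  -- Exact form of the second-order remainder, valid modulo s² = C²-1 and W² = 1+w².
  have hid : w / W - s / C + (C - W) / (C ^ 2 * s) =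
      -(((s - w) ^ 2 - (C - W) ^ 2) / (2 * s) / W) - (C - W) ^ 2 / (s * C ^ 2) / W := by
    have hW0 : W ≠ 0 := by linarith
    have hC0 : C ≠ 0 := by linarith
    have : w / W - s / C + (C - W) / (C ^ 2 * s) -
        (-(((s - w) ^ 2 - (C - W) ^ 2) / (2 * s) / W) - (C - W) ^ 2 / (s * C ^ 2) / W) =
        ((C ^ 2 - 2 * C * W) * (s ^ 2 - (C ^ 2 - 1)) - C ^ 2 * (W ^ 2 - (1 + w ^ 2))) /
          (2 * s * C ^ 2 * W) := by
      field_simp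
      ring
    rw [hsC, hW, sub_self, sub_self, mul_zero, mul_zero, sub_zero, zero_div] at this
    linarith
  have h3 : (s - w) ^ 2 ≤ (2 * C / s) ^ 2 * (C - W) ^ 2 := by
    rw [← mul_pow]
    exact pow_le_pow_left₀ h0 h2 2
  have hdiv : ∀ a : ℝ, |a / W| ≤ |a| := fun a => by
    rw [abs_div, abs_of_pos (by linarith : 0 < W)]
    exact div_le_self (abs_nonneg a) hW1
  rw [hid]
  refine (abs_sub _ _).trans ?_
  rw [abs_neg, add_mul]
  refine add_le_add ((hdiv _).trans ?_) ((hdiv _).trans ?_)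
  · rw [abs_div, abs_of_pos (by linarith : 0 < 2 * s), div_mul_eq_mul_div]
    gcongr
    rw [abs_le]
    constructor <;> nlinarith [sq_nonneg (s - w), sq_nonneg (C - W)]
  · rw [abs_of_nonneg (by positivity)]
    apply le_of_eq
    ring

end ScalarSoliton

/-! ### Second-order expansion of the slope and of the potential -/

namespace ScalarSoliton

theorem sq_add_add_le (a b c : ℝ) : (a + b + c) ^ 2 ≤ 3 * (a ^ 2 + b ^ 2 + c ^ 2) := by
  nlinarith [sq_nonneg (a - b), sq_nonneg (a - c), sq_nonneg (b - c)]

theorem mul_le_sq_add_sq (a b : ℝ) : a * b ≤ a ^ 2 + b ^ 2 := by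
  nlinarith [sq_nonneg (a - b), sq_nonneg (a + b)]

namespace IsProfile

variable {n : ℕ} {h Q : ℝ → ℝ} {C : ℝ}

/-- Here C - √(1+y) = b + e + β w/r with b = C - h = O(r⁻²). The slope has derivative 1/(C²s) with
respect to √(1+y) at the value C, where s = √(C²-1) is the limit of w, so the leading correction is
-β/(C²r). -/
theorem exists_slope_error_bound (hQ : IsProfile n h Q) (hn : 2 < n) (hC1 : 1 < C)
    (hC : ∀ r, 0 ≤ r → h r ≤ C)
    (hO : (fun r : ℝ => 1 - h r / C) =O[atTop] (fun r : ℝ => 1 / r ^ 2)) :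
    ∃ K R : ℝ, 1 ≤ R ∧ ∀ r, R < r →
      |r * gradFactor Q r - √(1 - 1 / C ^ 2) + 1 / C ^ 2 * √(((n : ℝ) - 2) / n) / r| ≤
        K * (1 / r ^ 2 + excess n h Q r) := by
  obtain ⟨M, hM, hMb⟩ := hO.exists_pos
  obtain ⟨R, hR⟩ := eventually_atTop.1 hMb.bound
  have hC0 : 0 < C := by linarith
  set s := √(C ^ 2 - 1)
  set β := √(((n : ℝ) - 2) / n)
  have hβ : 0 ≤ β := Real.sqrt_nonneg _
  have hs : 0 < s := Real.sqrt_pos.2 (by nlinarith)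
  have hsC : s ^ 2 = C ^ 2 - 1 := Real.sq_sqrt (by nlinarith)
  have hp : √(1 - 1 / C ^ 2) = s / C := by
    rw [← Real.sqrt_sq hC0.le, ← Real.sqrt_div (by nlinarith), Real.sqrt_sq hC0.le]
    congr 1
    field_simp
  set K₁ := (1 + (2 * C / s) ^ 2) / (2 * s) + 1 / (s * C ^ 2) with hK₁
  have hK₁0 : 0 ≤ K₁ := by positivity
  -- Constant of δ² ≤ K₂T, from δ² ≤ 3(b² + e² + β²(w/r)²) with b, e ≤ C and w ≤ s; in particular e²
  -- is absorbed by a multiple of e.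
  set K₂ := 3 * (C * (C * M) + C + β ^ 2 * s ^ 2) with hK₂
  refine ⟨K₁ * K₂ + (C * M + 1) / (C ^ 2 * s) + β / (C ^ 2 * s) * (2 * C / s) * (K₂ + 1),
    max R 1, le_max_right _ _, fun r hr => ?_⟩
  have hr1 : 1 < r := (le_max_right _ _).trans_lt hr
  have hr0 : 0 < r := by linarith
  set b := C - h r with hb
  have hb0 : 0 ≤ b := sub_nonneg.2 (hC r hr0.le)
  have hbM : b ≤ C * M * (1 / r ^ 2) := by
    have h1 := hR r ((le_max_left _ _).trans hr.le)
    rw [Real.norm_of_nonneg (by positivity : 0 ≤ 1 / r ^ 2)] at h1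
    have h2 := (le_abs_self _).trans h1
    rw [one_sub_div hC0.ne', div_le_iff₀ hC0] at h2
    linarith
  set e := excess n h Q r with he
  have he0 : 0 < e := hQ.excess_pos hn hr0.le
  set T := 1 / r ^ 2 + e with hT
  have hrT : 1 / r ^ 2 ≤ T := by linarith
  have heT : e ≤ T := by
    have : 0 < 1 / r ^ 2 := by positivity
    linarith
  have hT0 : 0 ≤ T := he0.le.trans heT
  have hy0 := hQ.sq_mul_nonneg hr0.le
  have hW1 : 1 ≤ √(1 + r ^ 2 * Q r) := Real.one_le_sqrt.2 (by linarith)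
  have hWh := hQ.sqrt_lt r hr0.le
  have hw : √(r ^ 2 * Q r) = r * √(Q r) := by
    rw [Real.sqrt_mul (sq_nonneg r), Real.sqrt_sq hr0.le]
  obtain ⟨hsw, hsw2, hX⟩ := abs_slope_expansion_le (W := √(1 + r ^ 2 * Q r)) hC1 hs hsC
    (Real.sqrt_nonneg (r ^ 2 * Q r)) hW1
    (by rw [Real.sq_sqrt (by linarith), Real.sq_sqrt hy0]) (hWh.le.trans (hC r hr0.le))
  rw [← hK₁] at hX
  rw [hQ.mul_gradFactor hr0.le, hp]
  set w := √(r ^ 2 * Q r)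
  set W := √(1 + r ^ 2 * Q r)
  set δ := C - W with hδ
  have hδe : δ = b + e + β * (w / r) := by
    rw [hw, mul_div_cancel_left₀ _ hr0.ne', hδ, hb, he, excess]
    ring
  have hw0 : 0 ≤ w := Real.sqrt_nonneg _
  have hwr : (w / r) ^ 2 ≤ s ^ 2 * T := by
    rw [div_pow, div_eq_mul_one_div]
    gcongr
    linarith
  have hwr0 : 0 ≤ β * (w / r) := by positivity
  have hδ0 : 0 ≤ δ := by rw [hδe]; positivity
  have hδC : δ ≤ C := by linarith
  have hbT : b ≤ C * M * T := hbM.trans (by gcongr)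
  have hδ2 : δ ^ 2 ≤ K₂ * T := by
    have h1 : δ ^ 2 ≤ 3 * (b ^ 2 + e ^ 2 + β ^ 2 * (w / r) ^ 2) := by
      rw [hδe, ← mul_pow]
      exact sq_add_add_le _ _ _
    have h2 : b ^ 2 ≤ C * (C * M * T) := by
      rw [sq]
      exact mul_le_mul (by linarith) hbT hb0 hC0.le
    have h3 : e ^ 2 ≤ C * T := by
      rw [sq]
      exact mul_le_mul (by linarith) heT he0.le hC0.le
    have h4 : β ^ 2 * (w / r) ^ 2 ≤ β ^ 2 * (s ^ 2 * T) := by gcongr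
    rw [hK₂]
    linarith
  have hδr : δ / r ≤ (K₂ + 1) * T := by
    have h1 : δ / r ≤ δ ^ 2 + 1 / r ^ 2 := by
      have h2 := mul_le_sq_add_sq δ (1 / r)
      rwa [mul_one_div, div_pow, one_pow] at h2
    linarith
  -- The first bracket is the Taylor remainder, of order δ². Replacing w by its limit s in β w/r
  -- costs a multiple of (s-w)/r, which is O(δ/r).
  have hdecomp : w / W - s / C + 1 / C ^ 2 * β / r = (w / W - s / C + δ / (C ^ 2 * s)) +
      (β / (C ^ 2 * s) * ((s - w) / r) - (b + e) / (C ^ 2 * s)) := by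
    rw [hδe]
    field_simp
    ring
  rw [hdecomp]
  have hsr0 : 0 ≤ (s - w) / r := div_nonneg hsw hr0.le
  have hsr : (s - w) / r ≤ 2 * C / s * ((K₂ + 1) * T) := by
    calc (s - w) / r ≤ 2 * C / s * δ / r := by gcongr
      _ = 2 * C / s * (δ / r) := by ring
      _ ≤ _ := by gcongr
  have hB : (b + e) / (C ^ 2 * s) ≤ (C * M + 1) / (C ^ 2 * s) * T := by
    rw [div_mul_eq_mul_div]
    gcongr
    linarith
  have hB0 : 0 ≤ (b + e) / (C ^ 2 * s) := by positivity
  have hA : β / (C ^ 2 * s) * ((s - w) / r) ≤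
      β / (C ^ 2 * s) * (2 * C / s * ((K₂ + 1) * T)) := by gcongr
  have hA0 : 0 ≤ β / (C ^ 2 * s) * ((s - w) / r) := by positivity
  have hX2 : K₁ * δ ^ 2 ≤ K₁ * (K₂ * T) := by gcongr
  have hsplit : |β / (C ^ 2 * s) * ((s - w) / r) - (b + e) / (C ^ 2 * s)| ≤
      β / (C ^ 2 * s) * ((s - w) / r) + (b + e) / (C ^ 2 * s) := by
    rw [abs_le]
    constructor <;> linarith
  refine (abs_add_le _ _).trans ((add_le_add hX hsplit).trans ?_)
  linarith

/-- The difference has derivative O(r⁻² + e), which is integrable at infinity, hence it converges.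
-/
theorem exists_tendsto_potential (hQ : IsProfile n h Q) (hn : 2 < n) (hh : Continuous h)
    (hC1 : 1 < C) (hC : ∀ r, 0 ≤ r → h r ≤ C) (hlim : Tendsto h atTop (𝓝 C))
    (hO : (fun r : ℝ => 1 - h r / C) =O[atTop] (fun r : ℝ => 1 / r ^ 2)) :
    ∃ c : ℝ, Tendsto (fun r => (∫ s in (0 : ℝ)..r, s * gradFactor Q s) -
      (√(1 - 1 / C ^ 2) * r - 1 / C ^ 2 * √(((n : ℝ) - 2) / n) * Real.log r)) atTop (𝓝 c) := by
  obtain ⟨K, R, hR1, hK⟩ := hQ.exists_slope_error_bound hn hC1 hC hO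
  have hcont := hQ.continuous_gradFactor
  refine ⟨_, MeasureTheory.tendsto_limUnder_of_hasDerivAt_of_integrableOn_Ioi (a := R)
    (f' := fun r => r * gradFactor Q r - √(1 - 1 / C ^ 2) + 1 / C ^ 2 * √(((n : ℝ) - 2) / n) / r)
    (fun r hr => ?_) ?_⟩
  · have hr0 : 0 < r := by linarith [mem_Ioi.1 hr]
    have := (hasDerivAt_integral_mul_self hcont r).sub
      (((hasDerivAt_id r).const_mul √(1 - 1 / C ^ 2)).sub
        ((Real.hasDerivAt_log hr0.ne').const_mul (1 / C ^ 2 * √(((n : ℝ) - 2) / n))))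
    convert! this using 1
    ring
  · have h1 : MeasureTheory.IntegrableOn (fun r : ℝ => 1 / r ^ 2) (Ioi R) := by
      have := integrableOn_Ioi_rpow_of_lt (a := -2) (by norm_num) (by linarith : 0 < R)
      refine this.congr_fun (fun r hr => ?_) measurableSet_Ioi
      have hr0 : 0 < r := by linarith [mem_Ioi.1 hr]
      simp only
      rw [Real.rpow_neg hr0.le, Real.rpow_two, one_div]
    have h2 := (hQ.integrableOn_excess hn hh hC hlim).mono_set (Ioi_subset_Ioi hR1)
    refine ((h1.add h2).const_mul K).mono' ?_
      ((MeasureTheory.ae_restrict_mem measurableSet_Ioi).mono fun r hr => hK r hr)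
    refine ContinuousOn.aestronglyMeasurable (fun r hr => ?_) measurableSet_Ioi
    have hr0 : r ≠ 0 := by linarith [mem_Ioi.1 hr]
    exact ContinuousAt.continuousWithinAt (by fun_prop (disch := assumption))

end IsProfile

end ScalarSoliton

/-! ### Convexity, regularity and curvature of the constructed solution -/

namespace ScalarSoliton

section Convexity

variable {E : Type*} [NormedAddCommGroup E] [InnerProductSpace ℝ E]

/-- Along the line through two points the second derivative is the quadratic form of `A`, so the
first derivative is strictly increasing. -/
theorem strictConvexOn_of_hasGradientAt_of_inner_pos [CompleteSpace E] {u : E → ℝ} {g : E → E}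
    {A : E → E →L[ℝ] E} (hu : ∀ x, HasGradientAt u (g x) x) (hg : ∀ x, HasFDerivAt g (A x) x)
    (hA : ∀ x v, v ≠ 0 → 0 < inner ℝ (A x v) v) : StrictConvexOn ℝ univ u := by
  refine ⟨convex_univ, fun x _ y _ hxy a b ha hb hab => ?_⟩
  set v := y - x with hv
  have hv0 : v ≠ 0 := sub_ne_zero.2 hxy.symm
  have hline : ∀ t : ℝ, HasDerivAt (fun t : ℝ => x + t • v) v t := fun t => by
    simpa using ((hasDerivAt_id t).smul_const v).const_add x
  have h1 : ∀ t : ℝ, HasDerivAt (fun t : ℝ => u (x + t • v)) (inner ℝ (g (x + t • v)) v) t :=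
    fun t => by simpa using! (hu (x + t • v)).hasFDerivAt.comp_hasDerivAt t (hline t)
  have h2 : ∀ t : ℝ, HasDerivAt (fun t : ℝ => inner ℝ (g (x + t • v)) v)
      (inner ℝ (A (x + t • v) v) v) t := fun t => by
    simpa using ((hg (x + t • v)).comp_hasDerivAt t (hline t)).inner ℝ (hasDerivAt_const t v)
  have h3 : StrictConvexOn ℝ univ fun t : ℝ => u (x + t • v) := by
    refine StrictMono.strictConvexOn_univ_of_deriv
      (continuous_iff_continuousAt.2 fun t => (h1 t).continuousAt) ?_
    rw [show deriv (fun t : ℝ => u (x + t • v)) = _ from funext fun t => (h1 t).deriv]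
    exact strictMono_of_deriv_pos fun t => by
      rw [(h2 t).deriv]
      exact hA _ _ hv0
  have h4 := h3.2 (mem_univ (0 : ℝ)) (mem_univ (1 : ℝ)) zero_ne_one ha hb hab
  simp only [smul_eq_mul, mul_zero, mul_one, zero_add, zero_smul, add_zero, one_smul] at h4
  have h5 : x + b • v = a • x + b • y := by
    rw [hv, ← sub_eq_iff_eq_add.2 hab.symm]
    module
  rw [h5, hv, add_sub_cancel] at h4
  exact h4

/-- The eigenvalues are f and f + b‖x‖². For b < 0, Cauchy–Schwarz reduces the form to the second
one. -/
theorem inner_radialDeriv_pos {f b : ℝ} {x v : E} (hf : 0 < f) (hfb : 0 < f + b * ‖x‖ ^ 2)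
    (hv : v ≠ 0) : 0 < inner ℝ (radialDeriv f b x v) v := by
  rw [radialDeriv_apply, inner_add_left, inner_smul_left, inner_smul_left,
    real_inner_self_eq_norm_sq]
  have h1 : inner ℝ x v ^ 2 ≤ ‖x‖ ^ 2 * ‖v‖ ^ 2 := by
    rw [← mul_pow, ← sq_abs (inner ℝ x v)]
    exact pow_le_pow_left₀ (abs_nonneg _) (abs_real_inner_le_norm x v) 2
  have h2 : 0 < ‖v‖ ^ 2 := by positivity
  simp only [RCLike.conj_to_real]
  rcases le_or_gt 0 b with hb | hb
  · have := mul_nonneg hb (sq_nonneg (inner ℝ x v))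
    nlinarith [mul_pos hf h2]
  · have := mul_le_mul_of_nonpos_left h1 hb.le
    nlinarith [mul_pos hfb h2]

end Convexity

theorem posDef_of_radial {n : ℕ} {x : EuclideanSpace ℝ (Fin n)} {f b : ℝ} (hf : 0 < f)
    (hfb : 0 < f + b * ‖x‖ ^ 2) :
    (f • (1 : Matrix (Fin n) (Fin n) ℝ) + b • Matrix.vecMulVec x x).PosDef := by
  refine Matrix.PosDef.of_dotProduct_mulVec_pos ?_ fun v hv => ?_
  · ext i j
    simp [Matrix.vecMulVec_apply, Matrix.one_apply, mul_comm, eq_comm]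
  · have h := inner_radialDeriv_pos (x := x) (v := WithLp.toLp 2 v) hf hfb (by simpa using hv)
    rw [radialDeriv_apply, inner_add_left, inner_smul_left, inner_smul_left] at h
    simp only [EuclideanSpace.inner_eq_star_dotProduct, star_trivial, RCLike.conj_to_real] at h
    rw [Matrix.add_mulVec, Matrix.smul_mulVec, Matrix.smul_mulVec, Matrix.one_mulVec,
      Matrix.vecMulVec_mulVec, dotProduct_add, dotProduct_smul, dotProduct_smul, star_trivial,
      op_smul_eq_smul, dotProduct_smul]
    simp only [smul_eq_mul]
    rw [dotProduct_comm x.ofLp v]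
    linarith

/-- The derivative of `gradFactor Q` on `(0, ∞)`. -/
noncomputable def gradFactorDeriv (n : ℕ) (h Q : ℝ → ℝ) (r : ℝ) : ℝ :=
  (n * ((h r - √(1 + r ^ 2 * Q r)) ^ 2 - Q r) / r * (1 + r ^ 2 * Q r) -
    Q r * (n * r * (h r - √(1 + r ^ 2 * Q r)) ^ 2 - (n - 2) * (r ^ 2 * Q r) / r)) /
      (1 + r ^ 2 * Q r) ^ 2 / (2 * √(Q r / (1 + r ^ 2 * Q r)))

namespace IsProfile

variable {n : ℕ} {h Q : ℝ → ℝ} {C : ℝ}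

theorem hasDerivAt_gradFactor (hQ : IsProfile n h Q) {r : ℝ} (hr : 0 < r) :
    HasDerivAt (gradFactor Q) (gradFactorDeriv n h Q r) r := by
  have hQr := hQ.pos r hr.le
  have h1 : 1 + r ^ 2 * Q r ≠ 0 := by positivity
  have h2 := ((hQ.hasDerivAt r hr).div ((hQ.hasDerivAt_sq_mul hr).const_add 1) h1).sqrt
    (by simp only [Pi.div_apply]; positivity)
  refine h2.congr_of_eventuallyEq ?_
  filter_upwards [lt_mem_nhds hr] with s hs
  simp [gradFactor, abs_of_pos hs]

theorem continuousOn_gradFactorDeriv (hQ : IsProfile n h Q) (hh : Continuous h) :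
    ContinuousOn (gradFactorDeriv n h Q) (Ioi 0) := by
  intro r hr
  have hr0 : 0 < r := hr
  have hQr := hQ.pos r hr0.le
  have hQc := hQ.continuous
  have h0 : r ≠ 0 := hr0.ne'
  have h1 : 1 + r ^ 2 * Q r ≠ 0 := by positivity
  have h2 : (1 + r ^ 2 * Q r) ^ 2 ≠ 0 := by positivity
  have h3 : 2 * √(Q r / (1 + r ^ 2 * Q r)) ≠ 0 := by positivity
  unfold gradFactorDeriv
  exact ContinuousAt.continuousWithinAt (by fun_prop (disch := assumption))

/-- After multiplication by r the expression is continuous at 0, and its value there is a multiple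
of (h 0 - 1)² - Q 0 = 0. This is what makes the solution C² at the origin. -/
theorem tendsto_mul_gradFactorDeriv (hQ : IsProfile n h Q) (hh : Continuous h) :
    Tendsto (fun r => r * gradFactorDeriv n h Q r) (𝓝[>] 0) (𝓝 0) := by
  have hQc := hQ.continuous
  set g : ℝ → ℝ := fun r => (n * ((h r - √(1 + r ^ 2 * Q r)) ^ 2 - Q r) * (1 + r ^ 2 * Q r) -
    Q r * (n * r ^ 2 * (h r - √(1 + r ^ 2 * Q r)) ^ 2 - (n - 2) * (r ^ 2 * Q r))) /
      (1 + r ^ 2 * Q r) ^ 2 / (2 * √(Q r / (1 + r ^ 2 * Q r))) with hg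
  have hQ0 := hQ.pos 0 le_rfl
  have hc : ContinuousAt g 0 := by
    have e1 : 1 + (0 : ℝ) ^ 2 * Q 0 ≠ 0 := by positivity
    have e2 : (1 + (0 : ℝ) ^ 2 * Q 0) ^ 2 ≠ 0 := by positivity
    have e3 : 2 * √(Q 0 / (1 + 0 ^ 2 * Q 0)) ≠ 0 := by positivity
    fun_prop (disch := assumption)
  have hg0 : g 0 = 0 := by simp [hg, hQ.zero]
  have ht := hc.tendsto.mono_left (nhdsWithin_le_nhds (s := Ioi 0))
  rw [hg0] at ht
  refine ht.congr' ?_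
  filter_upwards [self_mem_nhdsWithin] with r hr
  have hr0 : (0 : ℝ) < r := hr
  simp only [hg, gradFactorDeriv]
  field_simp

theorem gradFactor_pos (hQ : IsProfile n h Q) (r : ℝ) : 0 < gradFactor Q r :=
  Real.sqrt_pos.2 (div_pos (hQ.pos _ (abs_nonneg r)) (hQ.one_add_pos r))

theorem one_sub_gradFactor_sq (hQ : IsProfile n h Q) {r : ℝ} (hr : 0 ≤ r) :
    1 - (gradFactor Q r * r) ^ 2 = (1 + r ^ 2 * Q r)⁻¹ := by
  have h0 := hQ.sq_mul_nonneg hr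
  rw [mul_comm, hQ.mul_gradFactor hr, div_pow, Real.sq_sqrt h0, Real.sq_sqrt (by linarith)]
  field_simp
  ring

/-- Radial principal curvature of the soliton. -/
theorem radial_curvature_eq (hQ : IsProfile n h Q) {r : ℝ} (hr : 0 ≤ r) (h1 : 1 < h 0) :
    (gradFactor Q r + gradFactorDeriv n h Q r / r * r ^ 2) / √(1 - (gradFactor Q r * r) ^ 2) ^ 3 =
      (n * (h r - √(1 + r ^ 2 * Q r)) ^ 2 - (n - 2) * Q r) / (2 * √(Q r)) := by
  have hQr := hQ.pos r hr
  have hsQ := Real.sqrt_pos.2 hQr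
  have hsq := Real.sq_sqrt hQr.le
  have hy : 0 < 1 + r ^ 2 * Q r := by positivity
  have hW := Real.sqrt_pos.2 hy
  have hWsq := Real.sq_sqrt hy.le
  rw [hQ.one_sub_gradFactor_sq hr, Real.sqrt_inv]
  rcases hr.eq_or_lt with rfl | hr0
  -- At r = 0 the term with division by zero is killed by r², and both sides equal h 0 - 1.
  · have h0 : h 0 - 1 ≠ 0 := by linarith
    simp [gradFactor, hQ.zero, Real.sqrt_sq (by linarith : 0 ≤ h 0 - 1)]
    field_simp
    ring
  · rw [gradFactor, gradFactorDeriv, abs_of_nonneg hr, Real.sqrt_div hQr.le]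
    generalize (h r - √(1 + r ^ 2 * Q r)) ^ 2 = e
    generalize √(1 + r ^ 2 * Q r) = W at *
    generalize √(Q r) = q at *
    rw [← hWsq]
    rw [← hsq] at hWsq ⊢
    field_simp
    linear_combination (2 * q ^ 2 + n * e - n * q ^ 2) * hWsq

theorem tangential_curvature_eq (hQ : IsProfile n h Q) {r : ℝ} (hr : 0 ≤ r) :
    gradFactor Q r / √(1 - (gradFactor Q r * r) ^ 2) = √(Q r) := by
  have hQr := hQ.pos r hr
  have hy : 0 < 1 + r ^ 2 * Q r := by positivity
  have hW := Real.sqrt_pos.2 hy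
  rw [hQ.one_sub_gradFactor_sq hr, Real.sqrt_inv, gradFactor, abs_of_nonneg hr,
    Real.sqrt_div hQr.le]
  field_simp

theorem gradFactor_mul_sq_lt (hQ : IsProfile n h Q) {r : ℝ} (hr : 0 ≤ r) :
    (gradFactor Q r * r) ^ 2 < 1 := by
  have h1 := hQ.one_sub_gradFactor_sq hr
  have h2 : 0 < (1 + r ^ 2 * Q r)⁻¹ := inv_pos.2 (by linarith [hQ.sq_mul_nonneg hr])
  linarith

theorem radial_curvature_pos (hQ : IsProfile n h Q) {r : ℝ} (hr : 0 ≤ r) :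
    0 < (n * (h r - √(1 + r ^ 2 * Q r)) ^ 2 - (n - 2) * Q r) / (2 * √(Q r)) :=
  div_pos (sub_pos.2 (hQ.convex r hr)) (mul_pos two_pos (Real.sqrt_pos.2 (hQ.pos r hr)))

theorem gradFactor_add_pos (hQ : IsProfile n h Q) {r : ℝ} (hr : 0 ≤ r) (h1 : 1 < h 0) :
    0 < gradFactor Q r + gradFactorDeriv n h Q r / r * r ^ 2 := by
  have h2 := hQ.radial_curvature_pos hr
  rw [← hQ.radial_curvature_eq hr h1] at h2
  have h3 : 0 < √(1 - (gradFactor Q r * r) ^ 2) :=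
    Real.sqrt_pos.2 (sub_pos.2 (hQ.gradFactor_mul_sq_lt hr))
  exact (div_pos_iff_of_pos_right (pow_pos h3 3)).1 h2

theorem hessian_radialPotential (hQ : IsProfile n h Q) (x : EuclideanSpace ℝ (Fin n)) :
    hessian (radialPotential (gradFactor Q)) x =
      gradFactor Q ‖x‖ • (1 : Matrix (Fin n) (Fin n) ℝ) +
        (gradFactorDeriv n h Q ‖x‖ / ‖x‖) • Matrix.vecMulVec x x :=
  hessian_of_hasFDerivAt (hasFDerivAt_gradient_radialPotential hQ.continuous_gradFactor
    (fun _ hr => hQ.hasDerivAt_gradFactor hr) x)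

theorem curv_two_radialPotential (hQ : IsProfile n h Q) (hn : 2 < n) (h1 : 1 < h 0)
    (x : EuclideanSpace ℝ (Fin n)) : curv 2 (radialPotential (gradFactor Q)) x =
      (h ‖x‖ - √(1 + ‖x‖ ^ 2 * Q ‖x‖)) ^ 2 := by
  have hr := norm_nonneg x
  have hsQ := Real.sqrt_pos.2 (hQ.pos _ hr)
  have hn0 : (n : ℝ) ≠ 0 := by exact_mod_cast (by omega : n ≠ 0)
  rw [curv_two_of_radial (by omega) (congrFun (gradient_radialPotential hQ.continuous_gradFactor) x)
    (hQ.gradFactor_mul_sq_lt hr) (hQ.hessian_radialPotential x), hQ.radial_curvature_eq hr h1,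
    hQ.tangential_curvature_eq hr]
  have hsq := Real.sq_sqrt (hQ.pos _ hr).le
  field_simp
  rw [hsq]
  ring

theorem curv_one_radialPotential_pos (hQ : IsProfile n h Q) (hn : 2 < n) (h1 : 1 < h 0)
    (x : EuclideanSpace ℝ (Fin n)) : 0 < curv 1 (radialPotential (gradFactor Q)) x := by
  have hr := norm_nonneg x
  have hsQ := Real.sqrt_pos.2 (hQ.pos _ hr)
  have hn2 : (2 : ℝ) < n := by exact_mod_cast hn
  rw [curv_one_of_radial (by omega) (congrFun (gradient_radialPotential hQ.continuous_gradFactor) x)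
    (hQ.gradFactor_mul_sq_lt hr) (hQ.hessian_radialPotential x), hQ.radial_curvature_eq hr h1,
    hQ.tangential_curvature_eq hr]
  have := hQ.radial_curvature_pos hr
  have : 0 < ((n : ℝ) - 1) * √(Q ‖x‖) := mul_pos (by linarith) hsQ
  exact div_pos (by linarith) (by linarith)

theorem norm_gradient_radialPotential (hQ : IsProfile n h Q) (x : EuclideanSpace ℝ (Fin n)) :
    ‖gradient (radialPotential (gradFactor Q)) x‖ = gradFactor Q ‖x‖ * ‖x‖ := by
  rw [gradient_radialPotential hQ.continuous_gradFactor, norm_smul,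
    Real.norm_of_nonneg (hQ.gradFactor_pos _).le]

theorem admissible_radialPotential (hQ : IsProfile n h Q) (hn : 2 < n) (hh : Continuous h)
    (h1 : 1 < h 0) : Admissible (n := n) (radialPotential (gradFactor Q)) where
  contDiff := contDiff_two_radialPotential hQ.continuous_gradFactor
    (fun _ hr => hQ.hasDerivAt_gradFactor hr) (hQ.continuousOn_gradFactorDeriv hh)
    (hQ.tendsto_mul_gradFactorDeriv hh)
  spacelike x := by
    rw [hQ.norm_gradient_radialPotential, ← sq_lt_one_iff₀
      (mul_nonneg (hQ.gradFactor_pos _).le (norm_nonneg x))]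
    exact hQ.gradFactor_mul_sq_lt (norm_nonneg x)
  curv_one_pos := hQ.curv_one_radialPotential_pos hn h1
  curv_two_pos x := by
    rw [hQ.curv_two_radialPotential hn h1]
    exact pow_pos (sub_pos.2 (hQ.sqrt_lt _ (norm_nonneg x))) 2

theorem solves_radialPotential (hQ : IsProfile n h Q) (hn : 2 < n) (h1 : 1 < h 0) :
    SolvesDownwardSoliton (n := n) h (radialPotential (gradFactor Q)) := by
  intro x
  have hr := norm_nonneg x
  rw [hQ.curv_two_radialPotential hn h1, Real.sqrt_sq (sub_pos.2 (hQ.sqrt_lt _ hr)).le,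
    hQ.norm_gradient_radialPotential, hQ.one_sub_gradFactor_sq hr, Real.sqrt_inv, one_div, inv_inv]

theorem posDef_hessian_radialPotential (hQ : IsProfile n h Q) (h1 : 1 < h 0)
    (x : EuclideanSpace ℝ (Fin n)) : (hessian (radialPotential (gradFactor Q)) x).PosDef := by
  rw [hQ.hessian_radialPotential]
  exact posDef_of_radial (hQ.gradFactor_pos _) (hQ.gradFactor_add_pos (norm_nonneg x) h1)

theorem strictConvexOn_radialPotential (hQ : IsProfile n h Q) (h1 : 1 < h 0) :
    StrictConvexOn ℝ univ (radialPotential (n := n) (gradFactor Q)) := by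
  have hg := gradient_radialPotential (n := n) hQ.continuous_gradFactor
  refine strictConvexOn_of_hasGradientAt_of_inner_pos
    (hasGradientAt_radialPotential hQ.continuous_gradFactor)
    (fun x => hg ▸ hasFDerivAt_gradient_radialPotential hQ.continuous_gradFactor
      (fun _ hr => hQ.hasDerivAt_gradFactor hr) x)
    fun x v hv => inner_radialDeriv_pos (hQ.gradFactor_pos _)
      (hQ.gradFactor_add_pos (norm_nonneg x) h1) hv

end IsProfile

end ScalarSoliton

/-! ### Uniqueness among radial admissible solutions -/

namespace ScalarSoliton

theorem deriv_zero_of_even {g : ℝ → ℝ} (he : ∀ t, g (-t) = g t) :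
    deriv g 0 = 0 := by
  have h := deriv_comp_neg g 0
  simp only [he, neg_zero] at h
  linarith

section RadialSolution

variable {n : ℕ} {v : EuclideanSpace ℝ (Fin n) → ℝ} {e : EuclideanSpace ℝ (Fin n)}

theorem Radial.eq_comp_norm (hv : Radial v) (he : ‖e‖ = 1) (x : EuclideanSpace ℝ (Fin n)) :
    v x = v (‖x‖ • e) :=
  hv _ _ (by rw [norm_smul, he, norm_norm, mul_one])

theorem contDiff_two_line (hc : ContDiff ℝ 2 v) : ContDiff ℝ 2 fun t : ℝ => v (t • e) :=
  hc.comp (contDiff_id.smul contDiff_const)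

theorem gradient_of_radial (hv : Radial v) (hc : ContDiff ℝ 2 v) (he : ‖e‖ = 1)
    {x : EuclideanSpace ℝ (Fin n)} (hx : x ≠ 0) :
    gradient v x = (deriv (fun t : ℝ => v (t • e)) ‖x‖ / ‖x‖) • x := by
  have h := hasGradientAt_comp_norm hx
    (((contDiff_two_line (e := e) hc).differentiable two_ne_zero) ‖x‖).hasDerivAt
  rw [← h.gradient]
  congr 1
  exact funext (hv.eq_comp_norm he)

theorem hasFDerivAt_gradient_of_radial (hv : Radial v) (hc : ContDiff ℝ 2 v) (he : ‖e‖ = 1)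
    {x : EuclideanSpace ℝ (Fin n)} (hx : x ≠ 0) :
    HasFDerivAt (gradient v) (radialDeriv (deriv (fun t : ℝ => v (t • e)) ‖x‖ / ‖x‖)
      ((deriv (deriv fun t : ℝ => v (t • e)) ‖x‖ * ‖x‖ - deriv (fun t : ℝ => v (t • e)) ‖x‖) /
        ‖x‖ ^ 2 / ‖x‖) x) x := by
  have h1 : ContDiff ℝ 1 (deriv fun t : ℝ => v (t • e)) :=
    (contDiff_two_line (e := e) hc).deriv'
  have h2 := (h1.differentiable one_ne_zero ‖x‖).hasDerivAt.div (hasDerivAt_id ‖x‖)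
    (norm_ne_zero_iff.2 hx)
  have h3 := hasFDerivAt_radial_field hx h2
  simp only [Pi.div_apply, id_eq, mul_one] at h3
  refine h3.congr_of_eventuallyEq ?_
  filter_upwards [isOpen_ne.mem_nhds hx] with z hz
  exact gradient_of_radial hv hc he hz

end RadialSolution

/-- A radial admissible solution has the slope prescribed by the profile. -/
theorem IsProfile.deriv_radial_eq {n : ℕ} {h Q : ℝ → ℝ} (hQ : IsProfile n h Q) (hn : 2 < n)
    {v : EuclideanSpace ℝ (Fin n) → ℝ} {e : EuclideanSpace ℝ (Fin n)} (he : ‖e‖ = 1)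
    (hv : Radial v) (ha : Admissible v) (hs : SolvesDownwardSoliton h v) {r : ℝ} (hr : 0 ≤ r) :
    deriv (fun t : ℝ => v (t • e)) r = r * gradFactor Q r := by
  have hn2 : (2 : ℝ) < n := by exact_mod_cast hn
  set P := deriv fun t : ℝ => v (t • e) with hP
  have hline := contDiff_two_line (e := e) ha.contDiff
  have hPc : ContDiff ℝ 1 P := hline.deriv'
  have hPd : ∀ s, HasDerivAt P (deriv P s) s := fun s =>
    (hPc.differentiable one_ne_zero s).hasDerivAt
  have hP0 : P 0 = 0 := deriv_zero_of_even fun t =>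
    hv _ _ (by rw [neg_smul, norm_neg])
  have hnorm : ∀ s, 0 < s → ‖s • e‖ = s := fun s hs => by
    rw [norm_smul, he, mul_one, Real.norm_of_nonneg hs.le]
  have hne : ∀ s : ℝ, 0 < s → s • e ≠ 0 := fun s hs => norm_pos_iff.1 (by rwa [hnorm s hs])
  have hgrad : ∀ s, 0 < s → gradient v (s • e) = (P s / s) • s • e := fun s hs => by
    have := gradient_of_radial hv ha.contDiff he (hne s hs)
    rwa [hnorm s hs] at this
  have hgnorm : ∀ s, 0 < s → ‖gradient v (s • e)‖ ^ 2 = P s ^ 2 := fun s hs => by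
    rw [hgrad s hs, norm_smul, hnorm s hs, mul_pow, Real.norm_eq_abs, sq_abs, ← mul_pow,
      div_mul_cancel₀ _ hs.ne']
  have hP1 : ∀ s, 0 ≤ s → 0 < 1 - P s ^ 2 := by
    intro s hs
    rcases hs.eq_or_lt with rfl | hs
    · simp [hP0]
    · rw [← hgnorm s hs, sub_pos]
      exact (sq_lt_one_iff₀ (norm_nonneg _)).2 (ha.spacelike _)
  have hhess : ∀ s, 0 < s → hessian v (s • e) =
      (P s / s) • (1 : Matrix (Fin n) (Fin n) ℝ) +
        ((deriv P s * s - P s) / s ^ 2 / s) • Matrix.vecMulVec (s • e) (s • e) := fun s hs => by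
    have := hessian_of_hasFDerivAt
      (hasFDerivAt_gradient_of_radial hv ha.contDiff he (hne s hs))
    rwa [hnorm s hs] at this
  have hlt : ∀ s, 0 < s → (P s / s * ‖s • e‖) ^ 2 < 1 := fun s hs => by
    rw [hnorm s hs, div_mul_cancel₀ _ hs.ne']
    linarith [hP1 s hs.le]
  have hf1 : ∀ s, 0 < s → P s / s * s = P s := fun s hs => div_mul_cancel₀ _ hs.ne'
  have hf2 : ∀ s, 0 < s → P s / s + (deriv P s * s - P s) / s ^ 2 / s * s ^ 2 = deriv P s :=
    fun s hs => by
      field_simp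
      ring
  have hcurv1 : ∀ s, 0 < s → 0 < (n - 1) * (P s / s / √(1 - P s ^ 2)) +
      deriv P s / √(1 - P s ^ 2) ^ 3 := fun s hs => by
    have := ha.curv_one_pos (s • e)
    rw [curv_one_of_radial (by omega) (hgrad s hs) (hlt s hs) (hhess s hs), hnorm s hs, hf1 s hs,
      hf2 s hs] at this
    exact (div_pos_iff_of_pos_right (by linarith)).1 this
  have hcurv2 : ∀ s, 0 < s → curv 2 v (s • e) = P s / s / √(1 - P s ^ 2) *
      (2 * (deriv P s / √(1 - P s ^ 2) ^ 3) + (n - 2) * (P s / s / √(1 - P s ^ 2))) / n :=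
    fun s hs => by
      rw [curv_two_of_radial (by omega) (hgrad s hs) (hlt s hs) (hhess s hs), hnorm s hs, hf1 s hs,
        hf2 s hs]
  -- If the tangential curvature a were ≤ 0, then H_2 > 0 would give 2c + (n-2)a < 0 for the radial
  -- curvature c, while H_1 > 0 gives 2c + (2n-2)a > 0; subtracting, na > 0.
  have hPpos : ∀ s, 0 < s → 0 < P s := by
    intro s hs
    by_contra! hneg
    have h1 := hcurv1 s hs
    have h2 := ha.curv_two_pos (s • e)
    rw [hcurv2 s hs] at h2
    have h3 := (div_pos_iff_of_pos_right (by linarith : (0 : ℝ) < n)).1 h2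
    have ha0 : P s / s / √(1 - P s ^ 2) ≤ 0 :=
      div_nonpos_of_nonpos_of_nonneg (div_nonpos_of_nonpos_of_nonneg hneg hs.le)
        (Real.sqrt_nonneg _)
    generalize P s / s / √(1 - P s ^ 2) = a at *
    generalize deriv P s / √(1 - P s ^ 2) ^ 3 = c at *
    have h4 : 2 * c + (n - 2) * a < 0 := by
      by_contra! hc
      exact absurd h3 (not_lt.2 (mul_nonpos_of_nonpos_of_nonneg ha0 hc))
    nlinarith
  -- This is w² for the given solution, so that 1 + Y = 1/(1-P²); it satisfies the same equation as
  -- r²Q.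
  set Y : ℝ → ℝ := fun s => P s ^ 2 / (1 - P s ^ 2) with hY
  have hYadd : ∀ s, 0 ≤ s → 1 + Y s = (1 - P s ^ 2)⁻¹ := fun s hs => by
    have := (hP1 s hs).ne'
    simp only [hY]
    field_simp
    ring
  have heq : ∀ s, 0 < s → √(curv 2 v (s • e)) = h s - √(1 + Y s) := fun s hs' => by
    rw [hs (s • e), hnorm s hs', hgnorm s hs', hYadd s hs'.le, Real.sqrt_inv, one_div]
  have hYd : ∀ s, 0 < s →
      HasDerivAt Y (n * s * (h s - √(1 + Y s)) ^ 2 - (n - 2) * Y s / s) s := by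
    intro s hs
    have h1 := ((hPd s).pow 2).div (((hPd s).pow 2).const_sub 1) (hP1 s hs.le).ne'
    convert! h1 using 1
    rw [← heq s hs, Real.sq_sqrt (ha.curv_two_pos _).le, hcurv2 s hs]
    have h2 := hP1 s hs.le
    have h3 := Real.sqrt_pos.2 h2
    have h4 := Real.sq_sqrt h2.le
    simp only [hY, Pi.pow_apply, Nat.cast_ofNat, Nat.reduceSub, pow_one]
    generalize √(1 - P s ^ 2) = q at *
    rw [← h4]
    field_simp
    linear_combination (-2 * s * P s * deriv P s) * h4
  have hYQ : ∀ s, 0 < s → Y s = s ^ 2 * Q s := fun s hs =>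
    sq_profile_unique hn (Z := fun s => s ^ 2 * Q s)
      (fun s hs => by
        have := hP1 s hs
        exact (ContinuousAt.div (hPc.continuous.continuousAt.pow 2)
          (continuousAt_const.sub (hPc.continuous.continuousAt.pow 2)) this.ne').continuousWithinAt)
      ((continuous_id.pow 2).mul hQ.continuous).continuousOn
      (fun s hs => div_nonneg (sq_nonneg _) (hP1 s hs.le).le)
      (fun s hs => hQ.sq_mul_nonneg hs.le)
      (fun s hs => by linarith [heq s hs, Real.sqrt_nonneg (curv 2 v (s • e))])
      (fun s hs => (hQ.sqrt_lt s hs.le).le) hYd (fun s hs => hQ.hasDerivAt_sq_mul hs) hs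
  rcases hr.eq_or_lt with rfl | hr
  · rw [hP0, zero_mul]
  · have h1 := hP1 r hr.le
    rw [hQ.mul_gradFactor hr.le, ← hYQ r hr, hYadd r hr.le, Real.sqrt_inv, hY,
      Real.sqrt_div (sq_nonneg _), Real.sqrt_sq (hPpos r hr).le]
    have := Real.sqrt_pos.2 h1
    field_simp

/-- Along a ray both functions have the same derivative, so they differ by their values at the
origin. -/
theorem IsProfile.radial_solution_eq {n : ℕ} {h Q : ℝ → ℝ} (hQ : IsProfile n h Q) (hn : 2 < n)
    {v : EuclideanSpace ℝ (Fin n) → ℝ}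
    (hv : Radial v) (ha : Admissible v) (hs : SolvesDownwardSoliton h v)
    (x : EuclideanSpace ℝ (Fin n)) : v x = radialPotential (gradFactor Q) x + v 0 := by
  obtain ⟨e, he⟩ : ∃ e : EuclideanSpace ℝ (Fin n), ‖e‖ = 1 :=
    ⟨EuclideanSpace.single ⟨0, by omega⟩ 1, by simp⟩
  have hd : ∀ r, 0 ≤ r → HasDerivAt
      (fun t : ℝ => v (t • e) - ∫ s in (0 : ℝ)..t, s * gradFactor Q s) 0 r := fun r hr => by
    have h1 := ((contDiff_two_line (e := e) ha.contDiff).differentiable two_ne_zero r).hasDerivAt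
    rw [hQ.deriv_radial_eq hn he hv ha hs hr] at h1
    simpa using! h1.sub (hasDerivAt_integral_mul_self hQ.continuous_gradFactor r)
  have := constant_of_has_deriv_right_zero (a := 0) (b := ‖x‖)
    (fun r hr => (hd r hr.1).continuousAt.continuousWithinAt)
    (fun r hr => (hd r hr.1).hasDerivWithinAt) ‖x‖ ⟨norm_nonneg x, le_rfl⟩
  simp only [zero_smul, intervalIntegral.integral_same, sub_zero] at this
  rw [hv.eq_comp_norm he x, radialPotential]
  linarith

end ScalarSoliton

/-! ### The soliton theorem -/

theorem theorem1p1 (n : ℕ) (hn : 2 < n) (C : ℝ) (hC : 1 < C) (H : ℝ → ℝ)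
    (hmono : MonotoneOn H (Set.Ici 0))
    (hsmooth : ContDiff ℝ ∞ fun x : EuclideanSpace ℝ (Fin n) => H ‖x‖)
    (hinf : 1 < sInf (H '' Set.Ici 0))
    (hlim : Tendsto H atTop (𝓝 C)) :
    ∃ u : EuclideanSpace ℝ (Fin n) → ℝ,
      (ScalarSoliton.Radial u ∧ ScalarSoliton.Admissible u ∧
        ScalarSoliton.SolvesDownwardSoliton H u) ∧
      (StrictConvexOn ℝ Set.univ u ∧ ∀ x, (ScalarSoliton.hessian u x).PosDef) ∧
      Tendsto (fun x => ‖gradient u x‖) (Bornology.cobounded (EuclideanSpace ℝ (Fin n)))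
        (𝓝 √(1 - 1 / C ^ 2)) ∧
      ((fun r : ℝ => 1 - H r / C) =O[atTop] (fun r : ℝ => 1 / r ^ 2) →
        ∃ c₀ : ℝ, Tendsto
          (fun x : EuclideanSpace ℝ (Fin n) => u x -
            (√(1 - 1 / C ^ 2) * ‖x‖ - 1 / C ^ 2 * √(((n : ℝ) - 2) / n) * Real.log ‖x‖))
          (Bornology.cobounded (EuclideanSpace ℝ (Fin n))) (𝓝 c₀)) ∧
      ∀ v : EuclideanSpace ℝ (Fin n) → ℝ,
        ScalarSoliton.Radial v → ScalarSoliton.Admissible v →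
        ScalarSoliton.SolvesDownwardSoliton H v → ∃ c : ℝ, ∀ x, v x = u x + c := by
  -- `H` is arbitrary on negative reals; its even extension is continuous on ℝ, being the
  -- restriction of the smooth function H(|x|) to a line.
  set h : ℝ → ℝ := fun r => H |r| with hh
  have hhH : ∀ r, 0 ≤ r → h r = H r := fun r hr => by rw [hh]; simp only [abs_of_nonneg hr]
  have hcont : Continuous h := by
    have := hsmooth.continuous.comp (continuous_id.smul continuous_const : Continuous fun r : ℝ =>
      r • (EuclideanSpace.single (⟨0, by omega⟩ : Fin n) (1 : ℝ)))
    simpa [Function.comp_def, norm_smul] using this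
  have hHC : ∀ r, 0 ≤ r → H r ≤ C := fun r hr => ge_of_tendsto hlim <| by
    filter_upwards [eventually_ge_atTop r] with s hs
    exact hmono hr (hr.trans hs) hs
  have hhC : ∀ r, h r ≤ C := fun r => hHC _ (abs_nonneg r)
  have hh1 : 1 < h 0 := by
    rw [hhH 0 le_rfl]
    -- By monotonicity `H 0` is a lower bound of the image, as `csInf_le` requires.
    refine hinf.trans_le (csInf_le ⟨H 0, ?_⟩ ⟨0, self_mem_Ici, rfl⟩)
    rintro _ ⟨r, hr, rfl⟩
    exact hmono self_mem_Ici hr hr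
  have hhmono : MonotoneOn h (Ici 0) := hmono.congr fun r hr => (hhH r hr).symm
  have hheq : h =ᶠ[atTop] H := by
    filter_upwards [eventually_ge_atTop 0] with r hr using hhH r hr
  have hhlim : Tendsto h atTop (𝓝 C) := hlim.congr' hheq.symm
  have hsol : ∀ v : EuclideanSpace ℝ (Fin n) → ℝ,
      ScalarSoliton.SolvesDownwardSoliton h v ↔ ScalarSoliton.SolvesDownwardSoliton H v :=
    fun v => forall_congr' fun x => by rw [hhH _ (norm_nonneg x)]
  obtain ⟨Q, hQ⟩ := ScalarSoliton.exists_isProfile hn hcont hhC hh1 hhmono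
  have hnorm := tendsto_norm_cobounded_atTop (E := EuclideanSpace ℝ (Fin n))
  refine ⟨ScalarSoliton.radialPotential (ScalarSoliton.gradFactor Q),
    ⟨ScalarSoliton.radial_radialPotential _, hQ.admissible_radialPotential hn hcont hh1,
      (hsol _).1 (hQ.solves_radialPotential hn hh1)⟩,
    ⟨hQ.strictConvexOn_radialPotential hh1, hQ.posDef_hessian_radialPotential hh1⟩, ?_, ?_,
    fun v hv ha hs => ⟨v 0, hQ.radial_solution_eq hn hv ha ((hsol v).2 hs)⟩⟩
  · refine ((hQ.tendsto_mul_gradFactor hn hC (fun r _ => hhC r) hhlim).comp hnorm).congr fun x => ?_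
    rw [hQ.norm_gradient_radialPotential, Function.comp_apply, mul_comm]
  · intro hO
    have hO' : (fun r : ℝ => 1 - h r / C) =O[atTop] (fun r : ℝ => 1 / r ^ 2) :=
      hO.congr' (hheq.symm.mono fun r hr => by simp only [hr]) EventuallyEq.rfl
    obtain ⟨c, hc⟩ := hQ.exists_tendsto_potential hn hcont hC (fun r _ => hhC r) hhlim hO'
    exact ⟨c, hc.comp hnorm⟩
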